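/- **Setup.** All alphabets $\mathcal X,\mathcal Y,\mathcal A,\mathcal B$ are finite and logarithms are to base $2$. Let $Q_{XY}$ be a target pmf with $H(Y|X)=0$ (Node $\mathsf Y$'s action is a deterministic function of Node $\mathsf X$'s action), let $P_{B|A}$ be a discrete memoryless channel, and let $\mathbb C=\sup_{P_A} I(A;B)$ be its capacity. A *code* of block length $n\ge 1$ has a common randomness $J$ and local randomness $M_1$ (at Node $\mathsf X$) and $M_2$ (at Node $\mathsf Y$), each uniform on a finite set, such that $J$, $M_1$, $M_2$ and the actions $X^n$, which are i.i.d. with pmf $Q_X$, are independent. Node $\mathsf X$ selects a coordination message $I=I(X^n,J,M_1)$ from a finite set and sends the codeword $A^n=A^n(I,J)$ over the channel. Node $\mathsf Y$ receives $B^n$, forms an estimate $\hat I=\hat I(B^n,J)$ of the message and generates $Y^n=Y^n(B^n,J,M_2)$. Let $\hat P_{X^nY^n}$ be the induced pmf of the actions. The code is an *$\epsilon$-code* if $\|\hat P_{X^nY^n}-Q^n_{XY}\|_{TV}<\epsilon$. Its communication rate is $H(I|J)/n$. A tuple $(R_o,\rho_1,\rho_2)$ is *achievable* if for every $\epsilon>0$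 there are $n\ge1$ and an $\epsilon$-code of block length $n$ in which $J,M_1,M_2$ take $\lfloor 2^{nR_o}\rfloor,\lfloor 2^{n\rho_1}\rfloor,\lfloor 2^{n\rho_2}\rfloor$ values. It is *achievable with message rate $R_c$* if, in addition, these codes can be chosen such that $I$ takes values in a set of $\lfloor 2^{nR_c}\rfloor$ elements and $\mathbb P[\hat I\ne I]<\epsilon$. It is *achievable with full message rate $R_c$* if, moreover, they can be chosen such that also $H(I|J)/n>R_c-\epsilon$. **Proposition.** 1. (Achievability.) If $H(Y)<\mathbb C$, then every tuple $(R_o,\rho_1,\rho_2)$ of nonnegative rates is achievable, and it is achievable with message rate $R_c$ for every $R_c$ with $H(Y)<R_c<\mathbb C$. In particular this holds for $(0,0,0)$, so that neither common nor local randomness is needed. 2. (Converse for $\epsilon$-codes.) There is a function $\delta$ with $\delta(\epsilon)\to0$ as $\epsilon\to0^+$ such that for every $\epsilon>0$, every $\epsilon$-code, of any block length $n\ge1$ and with any numbers of values of $J,M_1,M_2,I$, satisfies $$H(Y)\le \tfrac1n H(I|J)+\delta(\epsilon)\quad\text{and}\quad H(Y)\le\mathbb C+\delta(\epsilon).$$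 3. (Converse.) If some tuple $(R_o,\rho_1,\rho_2)$ is achievable, then $H(Y)\le\mathbb C$. If it is achievable with message rate $R_c$, then $H(Y)\le R_c$. If it is achievable with full message rate $R_c$, then $H(Y)\le R_c\le\mathbb C$. -/

import Mathlib

/-! Strong coordination of two nodes over a discrete memoryless channel, finite alphabets.
A pmf on a finite alphabet `α` is an element of `stdSimplex ℝ α`; logarithms are to base 2. -/

namespace StrongCoord

section Information

variable {Ω α β : Type*} [Fintype Ω] [Fintype α] [Fintype β]

/-- The pmf of the random variable `f` when the sample point has pmf `p`. -/
noncomputable def push (p : Ω → ℝ) (f : Ω → α) (a : α) : ℝ :=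
  open Classical in ∑ ω, if f ω = a then p ω else 0

/-- Shannon entropy in bits, `H(p) = - ∑ p(a) log₂ p(a)`. -/
noncomputable def entropy (p : α → ℝ) : ℝ :=
  -∑ a, p a * Real.logb 2 (p a)

/-- Conditional entropy in bits of the second coordinate given the first one,
`- ∑ p(a,b) log₂ (p(a,b) / p(a))`. -/
noncomputable def condEntropy (p : α × β → ℝ) : ℝ :=
  -∑ z, p z * Real.logb 2 (p z / push p Prod.fst z.1)

/-- Mutual information in bits of the two coordinates. -/
noncomputable def mutualInfo (p : α × β → ℝ) : ℝ :=
  ∑ z, p z * Real.logb 2 (p z / (push p Prod.fst z.1 * push p Prod.snd z.2))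

/-- Total variation distance of two pmfs. -/
noncomputable def tvDist (p q : α → ℝ) : ℝ :=
  (1 / 2) * ∑ a, |p a - q a|

/-- The pmf of `n` independent copies. -/
def iid (p : α → ℝ) (n : ℕ) (x : Fin n → α) : ℝ :=
  ∏ i, p (x i)

/-- Capacity of the memoryless channel with transition pmfs `W a`: the supremum of `I(A;B)` over
all input pmfs. -/
noncomputable def capacity (W : α → β → ℝ) : ℝ :=
  sSup ((fun P : α → ℝ => mutualInfo (fun z : α × β => P z.1 * W z.1 z.2)) '' stdSimplex ℝ α)

end Information

/-- A block code for `n` actions. The common randomness takes `NJ` values, the local randomness at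
the two nodes takes `N1` and `N2` values, and the coordination message takes `NI` values.
Node X selects the message from the actions, the common randomness and its local randomness; the
message (with the common randomness) determines the channel input word. Node Y forms an estimate of
the message from the channel output and the common randomness, and generates its actions from the
channel output, the common randomness and its local randomness. -/
structure Code (X Y A B : Type*) (n NJ N1 N2 NI : ℕ) where
  message : (Fin n → X) → Fin NJ → Fin N1 → Fin NI
  codeword : Fin NI → Fin NJ → Fin n → A
  estimate : (Fin n → B) → Fin NJ → Fin NI
  action : (Fin n → B) → Fin NJ → Fin N2 → Fin n → Y

/-- Sample points `(x^n, j, m₁, m₂, b^n)`. -/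
abbrev Sample (X B : Type*) (n NJ N1 N2 : ℕ) : Type _ :=
  (Fin n → X) × Fin NJ × Fin N1 × Fin N2 × (Fin n → B)

namespace Code

variable {X Y A B : Type*} [Fintype X] [Fintype Y] [Fintype A] [Fintype B]
  {n NJ N1 N2 NI : ℕ}

/-- The message sent at a sample point. -/
def sent (c : Code X Y A B n NJ N1 N2 NI) (ω : Sample X B n NJ N1 N2) : Fin NI :=
  c.message ω.1 ω.2.1 ω.2.2.1

/-- The message estimate at a sample point. -/
def estimated (c : Code X Y A B n NJ N1 N2 NI) (ω : Sample X B n NJ N1 N2) : Fin NI :=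
  c.estimate ω.2.2.2.2 ω.2.1

/-- The actions of the two nodes at a sample point. -/
def actions (c : Code X Y A B n NJ N1 N2 NI) (ω : Sample X B n NJ N1 N2) : Fin n → X × Y :=
  fun i => (ω.1 i, c.action ω.2.2.2.2 ω.2.1 ω.2.2.2.1 i)

/-- The pmf of `(X^n, J, M₁, M₂, B^n)`: the actions of Node X are i.i.d. with pmf `PX`, the three
sources of randomness are uniform, all of these are independent, and the codeword is sent over the
memoryless channel `W`. -/
noncomputable def law (c : Code X Y A B n NJ N1 N2 NI) (PX : X → ℝ) (W : A → B → ℝ)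
    (ω : Sample X B n NJ N1 N2) : ℝ :=
  iid PX n ω.1 * (1 / (NJ : ℝ)) * (1 / (N1 : ℝ)) * (1 / (N2 : ℝ)) *
    ∏ i, W (c.codeword (c.sent ω) ω.2.1 i) (ω.2.2.2.2 i)

/-- Total variation distance between the pmf of the action sequences induced by the code and the
pmf of `n` independent copies of the target. -/
noncomputable def coordError (c : Code X Y A B n NJ N1 N2 NI) (Q : X × Y → ℝ)
    (W : A → B → ℝ) : ℝ :=
  tvDist (push (c.law (push Q Prod.fst) W) c.actions) (iid Q n)

/-- Probability that the message estimate at Node Y is wrong. -/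
noncomputable def messageError (c : Code X Y A B n NJ N1 N2 NI) (PX : X → ℝ)
    (W : A → B → ℝ) : ℝ :=
  open Classical in ∑ ω, if c.estimated ω ≠ c.sent ω then c.law PX W ω else 0

/-- The communication rate `H(I|J) / n` of the code, in bits per action. -/
noncomputable def messageRate (c : Code X Y A B n NJ N1 N2 NI) (PX : X → ℝ)
    (W : A → B → ℝ) : ℝ :=
  condEntropy (push (c.law PX W) (fun ω => (ω.2.1, c.sent ω))) / n

end Code

/-- The number of values `⌊2^(nR)⌋` available at rate `R` in block length `n`. -/
noncomputable def size (n : ℕ) (R : ℝ) : ℕ :=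
  ⌊(2 : ℝ) ^ ((n : ℝ) * R)⌋₊

section Achievable

variable {X Y A B : Type*} [Fintype X] [Fintype Y] [Fintype A] [Fintype B]

/-- `(Ro, ρ1, ρ2)` is achievable for strong coordination with target `Q` over the channel `W`. -/
def Achievable (Q : X × Y → ℝ) (W : A → B → ℝ) (Ro ρ1 ρ2 : ℝ) : Prop :=
  ∀ ε > 0, ∃ n NI : ℕ, 0 < n ∧
    ∃ c : Code X Y A B n (size n Ro) (size n ρ1) (size n ρ2) NI, c.coordError Q W < ε

/-- `(Ro, ρ1, ρ2)` is achievable with a coordination message from `⌊2^(n Rc)⌋` values that is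
reliably decoded at Node Y. -/
def AchievableWithMessage (Q : X × Y → ℝ) (W : A → B → ℝ) (Ro ρ1 ρ2 Rc : ℝ) : Prop :=
  ∀ ε > 0, ∃ n : ℕ, 0 < n ∧
    ∃ c : Code X Y A B n (size n Ro) (size n ρ1) (size n ρ2) (size n Rc),
      c.coordError Q W < ε ∧ c.messageError (push Q Prod.fst) W < ε

/-- As before, where moreover the message is asymptotically of full rate: its entropy
(given the common randomness) per action is at least `Rc`, up to `ε`. -/
def AchievableWithFullMessage (Q : X × Y → ℝ) (W : A → B → ℝ) (Ro ρ1 ρ2 Rc : ℝ) : Prop :=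
  ∀ ε > 0, ∃ n : ℕ, 0 < n ∧
    ∃ c : Code X Y A B n (size n Ro) (size n ρ1) (size n ρ2) (size n Rc),
      c.coordError Q W < ε ∧ c.messageError (push Q Prod.fst) W < ε ∧
        Rc - ε < c.messageRate (push Q Prod.fst) W

end Achievable

end StrongCoord

/-! Vanishing conditional entropy means that Y = f(X) for a function f
(`exists_eq_push_of_condEntropy_eq_zero`), so strong coordination amounts to near-lossless
reproduction of the word f(X^n) at Node Y. In one direction, the event Y^n ≠ f(X^n) is null for the
target, so its probability is at most the total variation distance (`sum_ite_le_tvDist`). In the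
other, the distance is at most the probability of that event, by coupling (`tvDist_push_le`).

Achievability is then separate coding. A source code of rate above H(Y)
(`eventually_exists_source_code`) is followed by a channel code of rate below capacity
(`eventually_exists_channel_code`, through Feinstein's maximal code). Both are deterministic, so no
randomness is used.

For the converse, f(X^n) is independent of (J, M₂) and has entropy nH(Y) (`condH_map_actions`).
Fano's inequality bounds what is left of it given B^n, J, M₂. Chain rules, together with the fact
that the channel noise depends on the past only through the input word (`condH_output`), bound the
rest by H(I|J), and also by nC after single-letterization (`condH_output_const_le`). Fano's term
grows at most linearly in n (`fano_mul_le`), which makes δ independent of the block length.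

All entropy inequalities except nonnegativity come from Gibbs' inequality `condH_le`, with a
suitable kernel for each. -/

namespace StrongCoord

/-! ### Laws of random variables on a finite sample space. -/

section Pushforward

variable {Ω α β γ : Type*} [Fintype Ω] {p : Ω → ℝ}

theorem push_apply [DecidableEq α] (p : Ω → ℝ) (f : Ω → α) (a : α) :
    push p f a = ∑ ω, if f ω = a then p ω else 0 := by
  unfold push
  congr! 2

theorem sum_push_mul [Fintype α] (p : Ω → ℝ) (f : Ω → α) (g : α → ℝ) :
    ∑ a, push p f a * g a = ∑ ω, p ω * g (f ω) := by
  classical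
  simp only [push_apply, Finset.sum_mul, ite_mul, zero_mul]
  rw [Finset.sum_comm]
  simp

theorem sum_push [Fintype α] (p : Ω → ℝ) (f : Ω → α) : ∑ a, push p f a = ∑ ω, p ω := by
  simpa using sum_push_mul p f (fun _ => 1)

theorem push_push [Fintype α] (p : Ω → ℝ) (f : Ω → α) (g : α → β) :
    push (push p f) g = push p (fun ω => g (f ω)) := by
  classical
  funext b
  have h := sum_push_mul p f (fun a => if g a = b then 1 else 0)
  simpa [push_apply] using h

theorem push_nonneg (hp : ∀ ω, 0 ≤ p ω) (f : Ω → α) (a : α) : 0 ≤ push p f a := by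
  classical
  rw [push_apply]
  exact Finset.sum_nonneg fun ω _ => by split_ifs <;> simp [hp]

theorem le_push (hp : ∀ ω, 0 ≤ p ω) (f : Ω → α) (ω : Ω) : p ω ≤ push p f (f ω) := by
  classical
  rw [push_apply]
  refine le_trans (by simp) (Finset.single_le_sum (f := fun ω' => if f ω' = f ω then p ω' else 0)
    (fun ω' _ => ?_) (Finset.mem_univ ω))
  split_ifs <;> simp [hp]

theorem push_pos (hp : ∀ ω, 0 ≤ p ω) (f : Ω → α) {ω : Ω} (h : 0 < p ω) : 0 < push p f (f ω) :=
  h.trans_le (le_push hp f ω)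

/-- Relabelling of values: it serves to permute coordinates in the chain rule and to drop a trivial
`Unit` coordinate. -/
theorem push_comp_injective (p : Ω → ℝ) (f : Ω → α) {e : α → β} (he : Function.Injective e)
    (a : α) : push p (fun ω => e (f ω)) (e a) = push p f a := by
  classical
  simp [push_apply, he.eq_iff]

theorem sum_push_pair [Fintype α] (p : Ω → ℝ) (f : Ω → α) (g : Ω → β) (b : β) :
    ∑ a, push p (fun ω => (g ω, f ω)) (b, a) = push p g b := by
  classical
  simp only [push_apply, Prod.mk.injEq]
  rw [Finset.sum_comm]
  refine Finset.sum_congr rfl fun ω _ => ?_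
  by_cases h : g ω = b <;> simp [h]

theorem push_mem_stdSimplex [Fintype α] (hp : p ∈ stdSimplex ℝ Ω) (f : Ω → α) : push p f ∈ stdSimplex ℝ α :=
  ⟨push_nonneg hp.1 f, (sum_push p f).trans hp.2⟩

theorem push_const (p : Ω → ℝ) (u : Unit) : push p (fun _ => ()) u = ∑ ω, p ω := by
  simp [push]

theorem push_unit_pair (p : Ω → ℝ) (f : Ω → α) (a : α) :
    push p (fun ω => ((), f ω)) ((), a) = push p f a :=
  push_comp_injective p f (e := fun a => ((), a)) (fun _ _ h => (Prod.mk.inj h).2) a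

end Pushforward

/-! ### Conditional entropy of random variables and Fano's inequality. -/

section ConditionalEntropy

variable {Ω α β γ : Type*} [Fintype Ω] {p : Ω → ℝ}

/-- Conditional entropy in bits of the random variable `f` given `g`. -/
noncomputable def condH (p : Ω → ℝ) (f : Ω → α) (g : Ω → β) : ℝ :=
  -∑ ω, p ω * Real.logb 2 (push p (fun ω => (g ω, f ω)) (g ω, f ω) / push p g (g ω))

theorem condEntropy_push [Fintype α] [Fintype β] (p : Ω → ℝ) (f : Ω → α) (g : Ω → β) :
    condEntropy (push p fun ω => (g ω, f ω)) = condH p f g := by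
  rw [condEntropy, condH, push_push]
  rw [sum_push_mul p (fun ω => (g ω, f ω)) (fun z => Real.logb 2
    (push p (fun ω => (g ω, f ω)) z / push p (fun ω => (g ω, f ω).1) z.1))]

/-- The conditional entropy is at most the cross entropy with any conditional pmf. -/
theorem condH_le [Fintype α] [Fintype β] (hp : p ∈ stdSimplex ℝ Ω) (f : Ω → α) (g : Ω → β) (q : β → α → ℝ)
    (hq : ∀ b a, 0 ≤ q b a) (hq1 : ∀ b, ∑ a, q b a ≤ 1)
    (hpq : ∀ ω, 0 < p ω → 0 < q (g ω) (f ω)) :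
    condH p f g ≤ -∑ ω, p ω * Real.logb 2 (q (g ω) (f ω)) := by
  set P := push p (fun ω => (g ω, f ω)) with hP
  have hlog2 : 0 < Real.log 2 := Real.log_pos one_lt_two
  -- This is log t ≤ t - 1, where t is the ratio of q to the true conditional pmf, weighted by p.
  have key : ∀ ω, p ω * Real.logb 2 (q (g ω) (f ω)) -
      p ω * Real.logb 2 (P (g ω, f ω) / push p g (g ω)) ≤
      (p ω * (q (g ω) (f ω) * push p g (g ω) / P (g ω, f ω)) - p ω) / Real.log 2 := by
    intro ω
    rcases (hp.1 ω).eq_or_lt with h | h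
    · simp [← h]
    · have h1 : 0 < P (g ω, f ω) := push_pos hp.1 (fun ω => (g ω, f ω)) h
      have h2 := push_pos hp.1 g h
      have h3 := hpq ω h
      have h4 : Real.logb 2 (q (g ω) (f ω)) - Real.logb 2 (P (g ω, f ω) / push p g (g ω)) =
          Real.log (q (g ω) (f ω) * push p g (g ω) / P (g ω, f ω)) / Real.log 2 := by
        rw [← Real.logb_div h3.ne' (by positivity), Real.logb, div_div_eq_mul_div]
      rw [← mul_sub, h4, ← mul_div_assoc]
      gcongr
      have := Real.log_le_sub_one_of_pos
        (show 0 < q (g ω) (f ω) * push p g (g ω) / P (g ω, f ω) by positivity)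
      nlinarith
  have hsum : ∑ ω, p ω * (q (g ω) (f ω) * push p g (g ω) / P (g ω, f ω)) ≤ 1 := by
    rw [← sum_push_mul p (fun ω => (g ω, f ω)) (fun z => q z.1 z.2 * push p g z.1 / P z), ← hP]
    calc ∑ z, P z * (q z.1 z.2 * push p g z.1 / P z) ≤ ∑ z : β × α, q z.1 z.2 * push p g z.1 := by
          refine Finset.sum_le_sum fun z _ => ?_
          have h0 := mul_nonneg (hq z.1 z.2) (push_nonneg hp.1 g z.1)
          by_cases hz : P z = 0
          · simpa [hz] using h0
          · rw [mul_div_cancel₀ _ hz]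
      _ ≤ ∑ b, push p g b := by
          rw [Fintype.sum_prod_type]
          refine Finset.sum_le_sum fun b _ => ?_
          simp only [← Finset.sum_mul]
          exact mul_le_of_le_one_left (push_nonneg hp.1 g b) (hq1 b)
      _ = 1 := (sum_push p g).trans hp.2
  have h := Finset.sum_le_sum fun ω (_ : ω ∈ Finset.univ) => key ω
  rw [Finset.sum_sub_distrib, ← Finset.sum_div, Finset.sum_sub_distrib, hp.2] at h
  have : (∑ ω, p ω * (q (g ω) (f ω) * push p g (g ω) / P (g ω, f ω)) - 1) / Real.log 2 ≤ 0 :=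
    div_nonpos_of_nonpos_of_nonneg (by linarith) hlog2.le
  rw [condH]
  linarith

/-- The factorization makes K the conditional pmf wherever g has positive probability; elsewhere the
weight is zero, so no normalization of K is required. -/
theorem condH_eq_of_kernel (hp : ∀ ω, 0 ≤ p ω) (f : Ω → α) (g : Ω → β) (K : β → α → ℝ)
    (hK : ∀ b a, push p (fun ω => (g ω, f ω)) (b, a) = push p g b * K b a) :
    condH p f g = -∑ ω, p ω * Real.logb 2 (K (g ω) (f ω)) := by
  rw [condH]
  congr 1
  refine Finset.sum_congr rfl fun ω _ => ?_
  rcases (hp ω).eq_or_lt with h | h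
  · simp [← h]
  · rw [hK, mul_div_cancel_left₀ _ (push_pos hp g h).ne']

theorem condH_nonneg [Fintype α] (hp : ∀ ω, 0 ≤ p ω) (f : Ω → α) (g : Ω → β) : 0 ≤ condH p f g := by
  rw [condH, ← Finset.sum_neg_distrib]
  refine Finset.sum_nonneg fun ω _ => ?_
  rcases (hp ω).eq_or_lt with h | h
  · simp [← h]
  · have h1 : 0 < push p (fun ω => (g ω, f ω)) (g ω, f ω) :=
      push_pos hp (fun ω => (g ω, f ω)) h
    have h2 := push_pos hp g h
    have h3 : push p (fun ω => (g ω, f ω)) (g ω, f ω) ≤ push p g (g ω) := by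
      rw [← sum_push_pair p f g]
      exact Finset.single_le_sum (f := fun a => push p (fun ω => (g ω, f ω)) (g ω, a))
        (fun a _ => push_nonneg hp _ _) (Finset.mem_univ _)
    have := Real.logb_nonpos one_lt_two (by positivity) ((div_le_one h2).2 h3)
    nlinarith

/-- The conditional pmf given the coarser variable is one of the kernels admitted by `condH_le`. The
same statement yields "conditioning reduces entropy" and the data processing used before Fano. -/
theorem condH_le_of_comp [Fintype α] [Fintype β] (hp : p ∈ stdSimplex ℝ Ω) (f : Ω → α) (g : Ω → β) (u : β → γ) :
    condH p f g ≤ condH p f (fun ω => u (g ω)) := by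
  refine condH_le hp f g (fun b a => push p (fun ω => (u (g ω), f ω)) (u b, a) /
    push p (fun ω => u (g ω)) (u b)) (fun b a => ?_) (fun b => ?_) (fun ω h => ?_)
  · exact div_nonneg (push_nonneg hp.1 _ _) (push_nonneg hp.1 _ _)
  · rw [← Finset.sum_div, sum_push_pair p f (fun ω => u (g ω))]
    exact div_self_le_one _
  · exact div_pos (push_pos hp.1 (fun ω => (u (g ω), f ω)) h)
      (push_pos hp.1 (fun ω => u (g ω)) h)

/-- Both sides are H(f₁, f₂ | g), expanded by the chain rule in the two orders. -/
theorem condH_add_condH (hp : ∀ ω, 0 ≤ p ω) (f₁ : Ω → α) (f₂ : Ω → β) (g : Ω → γ) :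
    condH p f₁ g + condH p f₂ (fun ω => (g ω, f₁ ω)) =
      condH p f₂ g + condH p f₁ (fun ω => (g ω, f₂ ω)) := by
  simp only [condH, ← neg_add, ← Finset.sum_add_distrib, ← mul_add]
  congr 1
  refine Finset.sum_congr rfl fun ω _ => ?_
  rcases (hp ω).eq_or_lt with h | h
  · simp [← h]
  · have h1 := (push_pos hp (fun ω => (g ω, f₁ ω)) h).ne'
    have h2 := (push_pos hp (fun ω => (g ω, f₂ ω)) h).ne'
    have h3 := (push_pos hp (fun ω => ((g ω, f₁ ω), f₂ ω)) h).ne'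
    have h4 := (push_pos hp (fun ω => ((g ω, f₂ ω), f₁ ω)) h).ne'
    have h5 := (push_pos hp g h).ne'
    have h6 : push p (fun ω => ((g ω, f₂ ω), f₁ ω)) ((g ω, f₂ ω), f₁ ω) =
        push p (fun ω => ((g ω, f₁ ω), f₂ ω)) ((g ω, f₁ ω), f₂ ω) :=
      push_comp_injective p (fun ω => ((g ω, f₁ ω), f₂ ω))
        (e := fun z : (γ × α) × β => ((z.1.1, z.2), z.1.2))
        (by rintro ⟨⟨a, b⟩, c⟩ ⟨⟨a', b'⟩, c'⟩ h; simp_all) ((g ω, f₁ ω), f₂ ω)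
    rw [Real.logb_div h1 h5, Real.logb_div h3 h1, Real.logb_div h2 h5, Real.logb_div h4 h2, h6]
    ring

theorem condH_le_logb_card [Fintype α] [Fintype β] (hp : p ∈ stdSimplex ℝ Ω) (f : Ω → α) (g : Ω → β) :
    condH p f g ≤ Real.logb 2 (Fintype.card α) := by
  have hc : ∀ ω, 0 < Fintype.card α := fun ω => Fintype.card_pos_iff.2 ⟨f ω⟩
  refine (condH_le hp f g (fun _ _ => 1 / (Fintype.card α : ℝ)) (fun _ _ => by positivity)
    (fun _ => ?_) (fun ω _ => ?_)).trans ?_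
  · simp only [Finset.sum_const, Finset.card_univ, nsmul_eq_mul, mul_one_div]
    exact div_self_le_one _
  · have := hc ω
    positivity
  · rw [← Finset.sum_mul, hp.2, one_div, Real.logb_inv]
    simp

/-- The bound of Fano's inequality for the error probability `ε` and `L` bits. -/
noncomputable def fano (ε L : ℝ) : ℝ :=
  -Real.logb 2 (1 - ε) - ε * Real.logb 2 ε + ε * L

/-- Cross entropy with the kernel that gives 1 - ε to the guess and ε/K to each other value. Its
total mass may be below 1, which `condH_le` permits. -/
theorem condH_le_fano [Fintype α] (hp : p ∈ stdSimplex ℝ Ω) [DecidableEq α] (f g : Ω → α) {ε : ℝ}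
    (hε : 0 < ε) (hε1 : ε < 1) (he : ∑ ω, (if g ω ≠ f ω then p ω else 0) ≤ ε) :
    condH p f g ≤ fano ε (Real.logb 2 (Fintype.card α)) := by
  set K : ℝ := (Fintype.card α : ℝ) with hKdef
  have hne : Nonempty Ω := by
    by_contra h
    rw [not_nonempty_iff] at h
    simpa using hp.2
  have hK : 1 ≤ K := by
    have : 0 < Fintype.card α := Fintype.card_pos_iff.2 ⟨f hne.some⟩
    rw [hKdef]
    exact_mod_cast this
  have hKε : 0 < ε / K := by positivity
  refine (condH_le hp f g (fun b a => if b = a then 1 - ε else ε / K) (fun b a => ?_)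
    (fun b => ?_) (fun ω _ => ?_)).trans ?_
  · split_ifs <;> linarith
  · calc ∑ a, (if b = a then 1 - ε else ε / K) ≤ ∑ a, ((if b = a then 1 - ε else 0) + ε / K) :=
          Finset.sum_le_sum fun a _ => by split_ifs <;> linarith
      _ = 1 - ε + K * (ε / K) := by simp [Finset.sum_add_distrib, hKdef]
      _ = 1 := by field_simp; ring
  · split_ifs <;> linarith
  · have hl1 : Real.logb 2 (1 - ε) ≤ 0 := Real.logb_nonpos one_lt_two (by linarith) (by linarith)
    have hl2 : Real.logb 2 (ε / K) ≤ 0 :=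
      Real.logb_nonpos one_lt_two hKε.le ((div_le_one (by linarith)).2 (by linarith))
    have h1 : ∀ ω, -(p ω * Real.logb 2 (if g ω = f ω then 1 - ε else ε / K)) ≤
        p ω * -Real.logb 2 (1 - ε) + (if g ω ≠ f ω then p ω else 0) * -Real.logb 2 (ε / K) := by
      intro ω
      have := hp.1 ω
      by_cases h : g ω = f ω
      · simp [h]
      · simp only [h, if_false, ne_eq, not_false_iff, if_true]
        nlinarith
    have h2 := Finset.sum_le_sum fun ω (_ : ω ∈ Finset.univ) => h1 ω
    rw [Finset.sum_add_distrib, ← Finset.sum_mul, ← Finset.sum_mul, hp.2,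
      Finset.sum_neg_distrib] at h2
    have h3 := mul_le_mul_of_nonneg_right he (neg_nonneg.2 hl2)
    rw [Real.logb_div hε.ne' (by linarith)] at h2 h3
    rw [fano]
    linarith

end ConditionalEntropy

/-! ### Mutual information and capacity of a channel. -/

section MutualInformation

variable {A B : Type*} [Fintype A] [Fintype B]

theorem mutualInfo_eq (P : A → ℝ) {W : A → B → ℝ}
    (hW : ∀ a, W a ∈ stdSimplex ℝ B) :
    mutualInfo (fun z : A × B => P z.1 * W z.1 z.2) =
      ∑ z : A × B, P z.1 * W z.1 z.2 *
        Real.logb 2 (W z.1 z.2 / push (fun z : A × B => P z.1 * W z.1 z.2) Prod.snd z.2) := by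
  classical
  have hfst : ∀ a, push (fun z : A × B => P z.1 * W z.1 z.2) Prod.fst a = P a := by
    intro a
    rw [push_apply, Fintype.sum_prod_type, Finset.sum_eq_single a]
    · simp [← Finset.mul_sum, (hW a).2]
    · intro b _ hb
      simp [hb]
    · simp
  rw [mutualInfo]
  refine Finset.sum_congr rfl fun z _ => ?_
  rw [hfst]
  by_cases h : P z.1 = 0
  · simp [h]
  · rw [mul_div_mul_left _ _ h]

theorem joint_mem_stdSimplex {P : A → ℝ} {W : A → B → ℝ} (hP : P ∈ stdSimplex ℝ A)
    (hW : ∀ a, W a ∈ stdSimplex ℝ B) :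
    (fun z : A × B => P z.1 * W z.1 z.2) ∈ stdSimplex ℝ (A × B) := by
  refine ⟨fun z => mul_nonneg (hP.1 _) ((hW _).1 _), ?_⟩
  simp [Fintype.sum_prod_type, ← Finset.mul_sum, (hW _).2, hP.2]

theorem mutualInfo_eq_condH {P : A → ℝ} {W : A → B → ℝ} (hP : P ∈ stdSimplex ℝ A)
    (hW : ∀ a, W a ∈ stdSimplex ℝ B) :
    mutualInfo (fun z : A × B => P z.1 * W z.1 z.2) =
      condH (fun z : A × B => P z.1 * W z.1 z.2) Prod.snd (fun _ => ()) -
        condH (fun z : A × B => P z.1 * W z.1 z.2) Prod.snd Prod.fst := by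
  have hj := joint_mem_stdSimplex hP hW
  simp only [mutualInfo, condH, Prod.mk.eta, push_const, hj.2, div_one, push_unit_pair,
    neg_sub_neg, ← Finset.sum_sub_distrib, ← mul_sub]
  refine Finset.sum_congr rfl fun z _ => ?_
  rcases (hj.1 z).eq_or_lt with h | h
  · simp [← h]
  · have h1 := (push_pos hj.1 Prod.fst h).ne'
    have h2 := (push_pos hj.1 Prod.snd h).ne'
    have h3 : push (fun z : A × B => P z.1 * W z.1 z.2) (fun ω => ω) z = P z.1 * W z.1 z.2 :=
      by classical simp [push_apply]
    have h4 : P z.1 * W z.1 z.2 ≠ 0 := h.ne'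
    rw [h3, Real.logb_div h4 (mul_ne_zero h1 h2), Real.logb_mul h1 h2, Real.logb_div h4 h1]
    ring

theorem mutualInfo_nonneg {P : A → ℝ} {W : A → B → ℝ} (hP : P ∈ stdSimplex ℝ A)
    (hW : ∀ a, W a ∈ stdSimplex ℝ B) : 0 ≤ mutualInfo (fun z : A × B => P z.1 * W z.1 z.2) := by
  rw [mutualInfo_eq_condH hP hW, sub_nonneg]
  exact condH_le_of_comp (joint_mem_stdSimplex hP hW) Prod.snd Prod.fst (fun _ => ())

theorem bddAbove_mutualInfo {W : A → B → ℝ} (hW : ∀ a, W a ∈ stdSimplex ℝ B) :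
    BddAbove ((fun P : A → ℝ => mutualInfo (fun z : A × B => P z.1 * W z.1 z.2)) ''
      stdSimplex ℝ A) := by
  refine ⟨Real.logb 2 (Fintype.card B), ?_⟩
  rintro _ ⟨P, hP, rfl⟩
  have hj := joint_mem_stdSimplex hP hW
  simp only [mutualInfo_eq_condH hP hW]
  linarith [condH_le_logb_card hj Prod.snd (fun _ => ()), condH_nonneg hj.1 Prod.snd Prod.fst]

theorem mutualInfo_le_capacity {P : A → ℝ} {W : A → B → ℝ} (hP : P ∈ stdSimplex ℝ A)
    (hW : ∀ a, W a ∈ stdSimplex ℝ B) :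
    mutualInfo (fun z : A × B => P z.1 * W z.1 z.2) ≤ capacity W :=
  le_csSup (bddAbove_mutualInfo hW) ⟨P, hP, rfl⟩

theorem capacity_nonneg {W : A → B → ℝ} (hW : ∀ a, W a ∈ stdSimplex ℝ B) : 0 ≤ capacity W :=
  Real.sSup_nonneg (by rintro _ ⟨P, hP, rfl⟩; exact mutualInfo_nonneg hP hW)

end MutualInformation

/-! ### Product laws and the weak law of large numbers. -/

section Memoryless

variable {α β : Type*} {n : ℕ}

theorem sum_prod_apply [Fintype α] (f : Fin n → α → ℝ) :
    ∑ x : Fin n → α, ∏ i, f i (x i) = ∏ i, ∑ a, f i a := by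
  classical
  rw [Finset.prod_univ_sum, Fintype.piFinset_univ]

theorem sum_prod_mul_apply [Fintype α] {f : Fin n → α → ℝ} (hf : ∀ i, ∑ a, f i a = 1) (i : Fin n) (g : α → ℝ) :
    ∑ x : Fin n → α, (∏ k, f k (x k)) * g (x i) = ∑ a, f i a * g a := by
  classical
  -- The test function is absorbed into the factor at coordinate i, so that the sum still
  -- factorizes.
  have h := sum_prod_apply (fun k a => f k a * if k = i then g a else 1)
  simp only [Finset.prod_mul_distrib, Finset.prod_ite_eq', Finset.mem_univ, if_true] at h
  rw [h, Finset.prod_eq_single i]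
  · simp
  · intro k _ hk
    simp [hk, hf]
  · simp

theorem sum_prod_mul_apply_mul_apply [Fintype α] {f : Fin n → α → ℝ} (hf : ∀ i, ∑ a, f i a = 1)
    {i j : Fin n} (hij : i ≠ j) (g g' : α → ℝ) :
    ∑ x : Fin n → α, (∏ k, f k (x k)) * (g (x i) * g' (x j)) =
      (∑ a, f i a * g a) * ∑ a, f j a * g' a := by
  classical
  have h := sum_prod_apply
    (fun k a => f k a * ((if k = i then g a else 1) * if k = j then g' a else 1))
  simp only [Finset.prod_mul_distrib, Finset.prod_ite_eq', Finset.mem_univ, if_true] at h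
  rw [h, Finset.prod_eq_mul i j hij]
  · simp [hij, hij.symm]
  · intro k _ hk
    simp [hk.1, hk.2, hf]
  · simp
  · simp

theorem iid_nonneg {p : α → ℝ} (hp : ∀ a, 0 ≤ p a) (n : ℕ) (x : Fin n → α) : 0 ≤ iid p n x :=
  Finset.prod_nonneg fun i _ => hp (x i)

theorem iid_pos {p : α → ℝ} (hp : ∀ a, 0 ≤ p a) {x : Fin n → α} (h : 0 < iid p n x) (i : Fin n) :
    0 < p (x i) :=
  (hp _).lt_of_ne' fun h0 => h.ne' (Finset.prod_eq_zero (Finset.mem_univ i) h0)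

theorem iid_mem_stdSimplex [Fintype α] {p : α → ℝ} (hp : p ∈ stdSimplex ℝ α) (n : ℕ) :
    iid p n ∈ stdSimplex ℝ (Fin n → α) := by
  refine ⟨iid_nonneg hp.1 n, ?_⟩
  simp [iid, sum_prod_apply (fun (_ : Fin n) a => p a), hp.2]

theorem sum_iid_mul_sum [Fintype α] {p : α → ℝ} (hp : p ∈ stdSimplex ℝ α) (n : ℕ) (g : α → ℝ) :
    ∑ x, iid p n x * ∑ i, g (x i) = n * ∑ a, p a * g a := by
  simp only [Finset.mul_sum]
  rw [Finset.sum_comm]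
  simp [iid, sum_prod_mul_apply (f := fun (_ : Fin n) a => p a) (fun _ => hp.2),
    Finset.mul_sum]

theorem push_iid [Fintype α] (p : α → ℝ) (f : α → β) (n : ℕ) :
    push (iid p n) (fun x i => f (x i)) = iid (push p f) n := by
  classical
  funext z
  have h := sum_prod_apply (fun i a => if f a = z i then p a else 0)
  simp only [Finset.prod_ite_zero, Finset.mem_univ, true_imp_iff] at h
  rw [push_apply, iid]
  simp only [push_apply, funext_iff]
  exact h

/-- Expanding the square, the cross terms vanish because distinct letters are independent and g is
centred. -/
theorem sum_iid_mul_sq [Fintype α] {p : α → ℝ} (hp : p ∈ stdSimplex ℝ α) (n : ℕ) {g : α → ℝ}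
    (hg : ∑ a, p a * g a = 0) :
    ∑ x, iid p n x * (∑ i, g (x i)) ^ 2 = n * ∑ a, p a * g a ^ 2 := by
  have h1 : ∀ x : Fin n → α, iid p n x * (∑ i, g (x i)) ^ 2 =
      ∑ i, ∑ j, (∏ k, p (x k)) * (g (x i) * g (x j)) := by
    intro x
    rw [sq, Finset.sum_mul_sum, Finset.mul_sum]
    simp only [Finset.mul_sum, iid]
  simp only [h1]
  rw [Finset.sum_comm]
  have h2 : ∀ i : Fin n, ∑ x : Fin n → α, ∑ j, (∏ k, p (x k)) * (g (x i) * g (x j)) =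
      ∑ a, p a * g a ^ 2 := by
    intro i
    rw [Finset.sum_comm, Finset.sum_eq_single i]
    · rw [sum_prod_mul_apply (f := fun (_ : Fin n) a => p a) (fun _ => hp.2) i
        (fun a => g a * g a)]
      simp [sq]
    · intro j _ hj
      rw [sum_prod_mul_apply_mul_apply (f := fun (_ : Fin n) a => p a) (fun _ => hp.2) hj.symm,
        hg, zero_mul]
    · simp
  simp [h2]

/-- Chebyshev's inequality for the empirical mean. -/
theorem sum_iid_deviation_le [Fintype α] {p : α → ℝ} (hp : p ∈ stdSimplex ℝ α) {n : ℕ} (hn : 0 < n)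
    {g : α → ℝ} (hg : ∑ a, p a * g a = 0) {δ : ℝ} (hδ : 0 < δ) :
    ∑ x : Fin n → α, (if n * δ ≤ |∑ i, g (x i)| then iid p n x else 0) ≤
      (∑ a, p a * g a ^ 2) / δ ^ 2 / n := by
  have hn' : (0 : ℝ) < n := by exact_mod_cast hn
  calc ∑ x : Fin n → α, (if n * δ ≤ |∑ i, g (x i)| then iid p n x else 0)
      ≤ ∑ x : Fin n → α, iid p n x * (∑ i, g (x i)) ^ 2 / (n * δ) ^ 2 := by
        refine Finset.sum_le_sum fun x _ => ?_
        have h0 := iid_nonneg hp.1 n x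
        split_ifs with h
        · rw [le_div_iff₀ (by positivity)]
          refine mul_le_mul_of_nonneg_left ?_ h0
          rw [← sq_abs (∑ i, g (x i))]
          gcongr
        · positivity
    _ = (∑ a, p a * g a ^ 2) / δ ^ 2 / n := by
        rw [← Finset.sum_div, sum_iid_mul_sq hp n hg]
        field_simp

/-- The weak law of large numbers on a finite alphabet. -/
theorem tendsto_sum_iid_deviation [Fintype α] {p : α → ℝ} (hp : p ∈ stdSimplex ℝ α) (g : α → ℝ) {δ : ℝ}
    (hδ : 0 < δ) :
    Filter.Tendsto (fun n : ℕ => ∑ x : Fin n → α,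
      (if n * δ ≤ |∑ i, g (x i) - n * ∑ a, p a * g a| then iid p n x else 0))
      Filter.atTop (nhds 0) := by
  set μ := ∑ a, p a * g a with hμ
  have hc : ∑ a, p a * (g a - μ) = 0 := by
    simp [mul_sub, Finset.sum_sub_distrib, ← Finset.sum_mul, hp.2, hμ]
  refine squeeze_zero' (Filter.Eventually.of_forall fun n => Finset.sum_nonneg fun x _ => ?_)
    (Filter.eventually_atTop.2 ⟨1, fun n hn => ?_⟩)
    (tendsto_const_div_atTop_nhds_zero_nat ((∑ a, p a * (g a - μ) ^ 2) / δ ^ 2))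
  · split_ifs
    · exact iid_nonneg hp.1 n x
    · exact le_rfl
  · simpa using sum_iid_deviation_le hp hn hc hδ

end Memoryless

/-! ### The law induced by a code: channel noise, single-letter bound, source entropy. -/

section Law

variable {X Y A B : Type*} [Fintype X] [Fintype B]
  {n NJ N1 N2 NI : ℕ} {PX : X → ℝ} {W : A → B → ℝ}

namespace Code

theorem sum_law_mul (c : Code X Y A B n NJ N1 N2 NI) (PX : X → ℝ) (W : A → B → ℝ)
    (φ : Sample X B n NJ N1 N2 → ℝ) :
    ∑ ω, c.law PX W ω * φ ω = ∑ x, ∑ j, ∑ m₁, ∑ m₂,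
      iid PX n x * (1 / (NJ : ℝ)) * (1 / (N1 : ℝ)) * (1 / (N2 : ℝ)) *
        ∑ b : Fin n → B, (∏ i, W (c.codeword (c.message x j m₁) j i) (b i)) *
          φ (x, j, m₁, m₂, b) := by
  simp only [Fintype.sum_prod_type, law, sent, Finset.mul_sum, mul_assoc]

theorem sum_output (hW : ∀ a, W a ∈ stdSimplex ℝ B) (a : Fin n → A) :
    ∑ b : Fin n → B, ∏ i, W (a i) (b i) = 1 := by
  rw [sum_prod_apply (fun i => W (a i))]
  simp [(hW _).2]

theorem sum_law_mul_fst (c : Code X Y A B n NJ N1 N2 NI) (hW : ∀ a, W a ∈ stdSimplex ℝ B)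
    (hJ : 0 < NJ) (h1 : 0 < N1) (h2 : 0 < N2) (φ : (Fin n → X) → ℝ) :
    ∑ ω, c.law PX W ω * φ ω.1 = ∑ x, iid PX n x * φ x := by
  rw [sum_law_mul]
  simp only [← Finset.sum_mul, sum_output hW]
  simp only [Finset.sum_const, Finset.card_univ, Fintype.card_fin, nsmul_eq_mul]
  refine Finset.sum_congr rfl fun x _ => ?_
  field_simp

theorem law_mem_stdSimplex (c : Code X Y A B n NJ N1 N2 NI) (hPX : PX ∈ stdSimplex ℝ X)
    (hW : ∀ a, W a ∈ stdSimplex ℝ B) (hJ : 0 < NJ) (h1 : 0 < N1) (h2 : 0 < N2) :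
    c.law PX W ∈ stdSimplex ℝ (Sample X B n NJ N1 N2) := by
  constructor
  · intro ω
    have := iid_nonneg hPX.1 n ω.1
    have := Finset.prod_nonneg fun i (_ : i ∈ Finset.univ) =>
      (hW (c.codeword (c.sent ω) ω.2.1 i)).1 (ω.2.2.2.2 i)
    rw [law]
    positivity
  · have := c.sum_law_mul_fst (PX := PX) hW hJ h1 h2 (fun _ => 1)
    simpa [(iid_mem_stdSimplex hPX n).2] using this

/-- The channel output word. -/
abbrev output (ω : Sample X B n NJ N1 N2) : Fin n → B := ω.2.2.2.2

/-- The channel input word. -/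
def input (c : Code X Y A B n NJ N1 N2 NI) (ω : Sample X B n NJ N1 N2) : Fin n → A :=
  c.codeword (c.sent ω) ω.2.1

/-- The conditional entropy of the channel output word given the input word. -/
noncomputable def noise (c : Code X Y A B n NJ N1 N2 NI) (PX : X → ℝ) (W : A → B → ℝ) : ℝ :=
  -∑ ω, c.law PX W ω * Real.logb 2 (∏ i, W (c.input ω i) (output ω i))

/-- A random variable that does not depend on the channel noise and determines the channel input
leaves exactly the uncertainty of the channel. -/
theorem condH_output {γ : Type*} (c : Code X Y A B n NJ N1 N2 NI) (hPX : PX ∈ stdSimplex ℝ X)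
    (hW : ∀ a, W a ∈ stdSimplex ℝ B) (hJ : 0 < NJ) (h1 : 0 < N1) (h2 : 0 < N2)
    (g : Sample X B n NJ N1 N2 → γ)
    (hg : ∀ x j m₁ m₂ b b', g (x, j, m₁, m₂, b) = g (x, j, m₁, m₂, b'))
    (k : γ → Fin n → A) (hk : ∀ ω, k (g ω) = c.input ω) :
    condH (c.law PX W) output g = c.noise PX W := by
  classical
  rw [condH_eq_of_kernel (c.law_mem_stdSimplex hPX hW hJ h1 h2).1 output g
    (fun w b => ∏ i, W (k w i) (b i)), noise]
  · simp only [hk]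
  · intro w b
    have e1 : push (c.law PX W) (fun ω => (g ω, output ω)) (w, b) =
        ∑ ω, c.law PX W ω * (if g ω = w then if output ω = b then 1 else 0 else 0) := by
      simp [push_apply, ite_and]
    have e2 : push (c.law PX W) g w = ∑ ω, c.law PX W ω * (if g ω = w then 1 else 0) := by
      simp [push_apply]
    rw [e1, e2, sum_law_mul, sum_law_mul]
    simp only [Finset.sum_mul]
    refine Finset.sum_congr rfl fun x _ => Finset.sum_congr rfl fun j _ =>
      Finset.sum_congr rfl fun m₁ _ => Finset.sum_congr rfl fun m₂ _ => ?_
    -- With the sources of randomness fixed, g no longer varies with the output word, so the sum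
    -- over outputs concerns the channel alone.
    simp only [hg x j m₁ m₂ _ b, output]
    rw [mul_assoc _ _ (∏ i, W (k w i) (b i))]
    congr 1
    by_cases h : g (x, j, m₁, m₂, b) = w
    · have hkw : k w = c.codeword (c.message x j m₁) j := by rw [← h, hk]; rfl
      simp [h, hkw, sum_output hW]
    · simp [h]

theorem push_input_output [Fintype A] (c : Code X Y A B n NJ N1 N2 NI)
    (hW : ∀ a, W a ∈ stdSimplex ℝ B) (i : Fin n) :
    push (c.law PX W) (fun ω => (c.input ω i, output ω i)) =
      fun z => push (c.law PX W) (fun ω => c.input ω i) z.1 * W z.1 z.2 := by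
  classical
  funext ⟨a, b⟩
  have e1 : push (c.law PX W) (fun ω => (c.input ω i, output ω i)) (a, b) =
      ∑ ω, c.law PX W ω * (if c.input ω i = a then if output ω i = b then 1 else 0 else 0) := by
    simp [push_apply, ite_and]
  have e2 : push (c.law PX W) (fun ω => c.input ω i) a =
      ∑ ω, c.law PX W ω * (if c.input ω i = a then 1 else 0) := by
    simp [push_apply]
  rw [e1, e2, sum_law_mul, sum_law_mul]
  simp only [Finset.sum_mul]
  refine Finset.sum_congr rfl fun x _ => Finset.sum_congr rfl fun j _ =>
    Finset.sum_congr rfl fun m₁ _ => Finset.sum_congr rfl fun m₂ _ => ?_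
  rw [mul_assoc _ _ (W a b)]
  congr 1
  simp only [input, output, sent]
  by_cases h : c.codeword (c.message x j m₁) j i = a
  · simp only [h, if_true, mul_one, sum_output hW, one_mul]
    rw [sum_prod_mul_apply (f := fun k => W (c.codeword (c.message x j m₁) j k))
      (fun k => (hW _).2) i (fun b' => if b' = b then 1 else 0)]
    simp [h]
  · simp [h]

/-- The entropy of the output word is at most its cross entropy with the product of its marginals.
Subtracting the noise leaves a sum over the letters of I(A_i; B_i), each at most the capacity. -/
theorem condH_output_const_le [Fintype A] (c : Code X Y A B n NJ N1 N2 NI) (hPX : PX ∈ stdSimplex ℝ X)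
    (hW : ∀ a, W a ∈ stdSimplex ℝ B) (hJ : 0 < NJ) (h1 : 0 < N1) (h2 : 0 < N2) :
    condH (c.law PX W) output (fun _ => ()) ≤ c.noise PX W + n * capacity W := by
  have hp := c.law_mem_stdSimplex hPX hW hJ h1 h2
  set p := c.law PX W with hpdef
  have hle := condH_le hp output (fun _ => ())
    (fun _ b => ∏ i, push p (fun ω => output ω i) (b i))
    (fun _ b => Finset.prod_nonneg fun i _ => push_nonneg hp.1 _ _)
    (fun _ => by
      rw [sum_prod_apply (fun i => push p (fun ω => output ω i))]
      simp [sum_push, hp.2])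
    (fun ω h => Finset.prod_pos fun i _ => push_pos hp.1 (fun ω => output ω i) h)
  have hWpos : ∀ ω, 0 < p ω → ∀ i, 0 < W (c.input ω i) (output ω i) := by
    intro ω h i
    refine ((hW _).1 _).lt_of_ne' fun h0 => h.ne' ?_
    rw [hpdef, law, Finset.prod_eq_zero (Finset.mem_univ i) h0, mul_zero]
  have hsum : ∑ ω, p ω * Real.logb 2 (∏ i, W (c.input ω i) (output ω i)) -
      ∑ ω, p ω * Real.logb 2 (∏ i, push p (fun ω => output ω i) (output ω i)) =
      ∑ i, ∑ ω, p ω * Real.logb 2 (W (c.input ω i) (output ω i) /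
        push p (fun ω => output ω i) (output ω i)) := by
    rw [← Finset.sum_sub_distrib, Finset.sum_comm]
    refine Finset.sum_congr rfl fun ω _ => ?_
    rcases (hp.1 ω).eq_or_lt with h | h
    · simp [← h]
    · have h3 := fun i => (hWpos ω h i).ne'
      have h4 := fun i => (push_pos hp.1 (fun ω => output ω i) h).ne'
      rw [Real.logb_prod _ _ (fun i _ => h3 i), Real.logb_prod _ _ (fun i _ => h4 i),
        ← mul_sub, ← Finset.sum_sub_distrib, Finset.mul_sum]
      exact Finset.sum_congr rfl fun i _ => by rw [Real.logb_div (h3 i) (h4 i)]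
  have hcap : ∀ i, ∑ ω, p ω * Real.logb 2 (W (c.input ω i) (output ω i) /
      push p (fun ω => output ω i) (output ω i)) ≤ capacity W := by
    intro i
    refine le_of_eq_of_le ?_ (mutualInfo_le_capacity
      (push_mem_stdSimplex hp (fun ω => c.input ω i)) hW)
    have hz : ∀ z : A × B, push p (fun ω => c.input ω i) z.1 * W z.1 z.2 =
        push p (fun ω => (c.input ω i, output ω i)) z :=
      fun z => (congrFun (c.push_input_output hW i) z).symm
    rw [mutualInfo_eq _ hW]
    simp only [hz, push_push]
    exact (sum_push_mul p (fun ω => (c.input ω i, output ω i))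
      (fun z => Real.logb 2 (W z.1 z.2 / push p (fun ω => output ω i) z.2))).symm
  have hcap' := Finset.sum_le_sum fun i (_ : i ∈ Finset.univ) => hcap i
  rw [← hsum] at hcap'
  simp only [Finset.sum_const, Finset.card_univ, Fintype.card_fin, nsmul_eq_mul] at hcap'
  rw [noise]
  linarith

/-- The letterwise image of the actions of Node X keeps its full entropy given the randomness that
is available at Node Y. -/
theorem condH_map_actions (c : Code X Y A B n NJ N1 N2 NI) (hPX : PX ∈ stdSimplex ℝ X)
    (hW : ∀ a, W a ∈ stdSimplex ℝ B) (hJ : 0 < NJ) (h1 : 0 < N1) (h2 : 0 < N2)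
    [Fintype Y] (f : X → Y) :
    condH (c.law PX W) (fun ω i => f (ω.1 i)) (fun ω => (ω.2.1, ω.2.2.2.1)) =
      n * entropy (push PX f) := by
  classical
  have hp := c.law_mem_stdSimplex hPX hW hJ h1 h2
  rw [condH_eq_of_kernel hp.1 _ _ (fun _ z => iid (push PX f) n z)]
  · rw [c.sum_law_mul_fst hW hJ h1 h2
      (fun x => Real.logb 2 (iid (push PX f) n (fun i => f (x i)))), entropy,
      sum_push_mul PX f (fun y => Real.logb 2 (push PX f y)), mul_neg,
      ← sum_iid_mul_sum hPX n (fun a => Real.logb 2 (push PX f (f a)))]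
    congr 1
    refine Finset.sum_congr rfl fun x _ => ?_
    rcases (iid_nonneg hPX.1 n x).eq_or_lt with h | h
    · simp [← h]
    · rw [iid, iid, Real.logb_prod]
      exact fun i _ => (push_pos hPX.1 f (iid_pos hPX.1 h i)).ne'
  · rintro ⟨j, m₂⟩ z
    have e1 : push (c.law PX W) (fun ω => ((ω.2.1, ω.2.2.2.1), fun i => f (ω.1 i))) ((j, m₂), z) =
        ∑ ω, c.law PX W ω * (if ω.2.1 = j then if ω.2.2.2.1 = m₂ then
          if (fun i => f (ω.1 i)) = z then 1 else 0 else 0 else 0) := by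
      simp [push_apply, ite_and]
    have e2 : push (c.law PX W) (fun ω => (ω.2.1, ω.2.2.2.1)) (j, m₂) =
        ∑ ω, c.law PX W ω * (if ω.2.1 = j then if ω.2.2.2.1 = m₂ then 1 else 0 else 0) := by
      simp [push_apply, ite_and]
    rw [e1, e2, sum_law_mul, sum_law_mul, ← push_iid, push_apply]
    simp only [← Finset.sum_mul, sum_output hW, one_mul, mul_ite, mul_zero, mul_one,
      Finset.sum_ite_eq', Finset.mem_univ, if_true, Finset.sum_const, Finset.card_univ,
      Fintype.card_fin, nsmul_eq_mul, (iid_mem_stdSimplex hPX n).2, ← Finset.mul_sum,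
      Finset.sum_ite_irrel]
    rw [Finset.mul_sum]
    refine Finset.sum_congr rfl fun x _ => ?_
    split_ifs <;> ring

end Code

end Law

/-! ### Total variation distance and error events. -/

section TotalVariation

variable {Ω α : Type*} [Fintype Ω] [Fintype α] {p : Ω → ℝ}

theorem tvDist_push_le [DecidableEq α] (hp : ∀ ω, 0 ≤ p ω) (f g : Ω → α) :
    tvDist (push p f) (push p g) ≤ ∑ ω, if f ω ≠ g ω then p ω else 0 := by
  have h1 : ∀ a, |push p f a - push p g a| ≤
      ∑ ω, if f ω ≠ g ω then (if f ω = a then p ω else 0) + (if g ω = a then p ω else 0) else 0 := by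
    intro a
    rw [push_apply, push_apply, ← Finset.sum_sub_distrib]
    refine (Finset.abs_sum_le_sum_abs _ _).trans (Finset.sum_le_sum fun ω _ => ?_)
    have := hp ω
    by_cases h : f ω = g ω
    · simp [h]
    · rw [if_pos h]
      split_ifs <;> simp [abs_of_nonneg this, this]
  have h2 := Finset.sum_le_sum fun a (_ : a ∈ Finset.univ) => h1 a
  rw [Finset.sum_comm] at h2
  have h3 : ∀ ω, ∑ a, (if f ω ≠ g ω then (if f ω = a then p ω else 0) +
      (if g ω = a then p ω else 0) else 0) = 2 * if f ω ≠ g ω then p ω else 0 := by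
    intro ω
    split_ifs
    · simp [Finset.sum_add_distrib, two_mul]
    · simp
  simp only [h3, ← Finset.mul_sum] at h2
  rw [tvDist]
  linarith

/-- The probability of an event that is null for `q` is at most the total variation distance
to `q`. -/
theorem sum_ite_le_tvDist (hp : p ∈ stdSimplex ℝ Ω) (f : Ω → α) {q : α → ℝ}
    (hq : q ∈ stdSimplex ℝ α) (E : α → Prop) [DecidablePred E] (hE : ∀ a, E a → q a = 0) :
    ∑ ω, (if E (f ω) then p ω else 0) ≤ tvDist (push p f) q := by
  have h1 : ∑ ω, (if E (f ω) then p ω else 0) = ∑ a, if E a then push p f a else 0 := by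
    simpa using (sum_push_mul p f (fun a => if E a then 1 else 0)).symm
  have h2 : ∀ a, (if E a then push p f a else 0) ≤
      (1 / 2) * |push p f a - q a| + (1 / 2) * (push p f a - q a) := by
    intro a
    have := le_abs_self (push p f a - q a)
    have := neg_abs_le (push p f a - q a)
    split_ifs with h
    · rw [hE a h] at *
      linarith
    · linarith
  rw [h1, tvDist]
  refine (Finset.sum_le_sum fun a _ => h2 a).trans ?_
  rw [Finset.sum_add_distrib, ← Finset.mul_sum, ← Finset.mul_sum, Finset.sum_sub_distrib,
    sum_push, hp.2, hq.2]
  simp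

end TotalVariation

/-! ### Vanishing conditional entropy yields a function. -/

section Deterministic

variable {X Y : Type*} [Fintype X] [Fintype Y] {Q : X × Y → ℝ}

/-- A joint pmf with vanishing conditional entropy is that of `(x, f x)` for a function `f`. -/
theorem exists_eq_push_of_condEntropy_eq_zero (hQ : Q ∈ stdSimplex ℝ (X × Y))
    (h : condEntropy Q = 0) : ∃ f : X → Y, Q = push (push Q Prod.fst) (fun x => (x, f x)) := by
  classical
  have hsum : ∀ x, push Q Prod.fst x = ∑ y, Q (x, y) := by
    intro x
    rw [push_apply, Fintype.sum_prod_type, Finset.sum_eq_single x]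
    · simp
    · intro b _ hb
      simp [hb]
    · simp
  have hle : ∀ z : X × Y, Q z ≤ push Q Prod.fst z.1 := le_push hQ.1 Prod.fst
  -- The entropy is a sum of nonnegative terms, so each vanishes: every conditional probability is 0
  -- or 1.
  have hdich : ∀ z : X × Y, Q z = 0 ∨ Q z = push Q Prod.fst z.1 := by
    have hterm : ∀ z ∈ Finset.univ, 0 ≤ -(Q z * Real.logb 2 (Q z / push Q Prod.fst z.1)) := by
      intro z _
      have := Real.logb_nonpos one_lt_two
        (div_nonneg (hQ.1 z) (push_nonneg hQ.1 Prod.fst z.1))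
        (div_le_one_of_le₀ (hle z) (push_nonneg hQ.1 Prod.fst z.1))
      nlinarith [hQ.1 z]
    rw [condEntropy, ← Finset.sum_neg_distrib, Finset.sum_eq_zero_iff_of_nonneg hterm] at h
    intro z
    rcases (hQ.1 z).eq_or_lt with h0 | h0
    · exact Or.inl h0.symm
    · right
      have h1 := push_pos hQ.1 Prod.fst h0
      have h2 := h z (Finset.mem_univ z)
      rw [neg_eq_zero, mul_eq_zero, or_iff_right h0.ne'] at h2
      by_contra hne
      have h3 : Q z / push Q Prod.fst z.1 < 1 := (div_lt_one h1).2 ((hle z).lt_of_ne hne)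
      exact (Real.logb_neg one_lt_two (div_pos h0 h1) h3).ne h2
  have hne : Nonempty (X × Y) := by
    by_contra h
    rw [not_nonempty_iff] at h
    simpa using hQ.2
  have hex : ∀ x, ∃ y, ∀ y', Q (x, y') = if y = y' then push Q Prod.fst x else 0 := by
    intro x
    by_cases hx : ∃ y, Q (x, y) ≠ 0
    · obtain ⟨y, hy⟩ := hx
      have hy1 := (hdich (x, y)).resolve_left hy
      refine ⟨y, fun y' => ?_⟩
      split_ifs with hyy
      · rw [← hyy, hy1]
      · have := Finset.sum_le_sum_of_subset_of_nonneg (Finset.subset_univ {y, y'})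
          (f := fun y => Q (x, y)) (fun i _ _ => hQ.1 _)
        rw [Finset.sum_pair hyy, ← hsum, hy1] at this
        have := hQ.1 (x, y')
        dsimp only at *
        linarith
    · push Not at hx
      -- For x of probability zero any value of f will do.
      refine ⟨hne.some.2, fun y' => ?_⟩
      rw [hsum, hx]
      simp [hx]
  choose f hf using hex
  refine ⟨f, funext fun ⟨x, y⟩ => ?_⟩
  rw [hf, push_apply (push Q Prod.fst), Finset.sum_eq_single x]
  · simp
  · intro b _ hb
    simp [hb]
  · simp

end Deterministic

/-! ### Fano's bound: scaling with the block length and limit at zero error. -/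

section Fano

theorem fano_mul_le {ε : ℝ} (hε : 0 < ε) (hε1 : ε < 1) (L : ℝ) {n : ℝ} (hn : 1 ≤ n) :
    fano ε (n * L) ≤ n * fano ε L := by
  have h1 : Real.logb 2 (1 - ε) ≤ 0 := Real.logb_nonpos one_lt_two (by linarith) (by linarith)
  have h2 : Real.logb 2 ε ≤ 0 := Real.logb_nonpos one_lt_two hε.le hε1.le
  simp only [fano]
  nlinarith [mul_nonneg (sub_nonneg.2 hn) (neg_nonneg.2 h1),
    mul_nonneg (sub_nonneg.2 hn) (mul_nonneg hε.le (neg_nonneg.2 h2))]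

theorem tendsto_fano (L : ℝ) :
    Filter.Tendsto (fun ε => fano ε L) (nhdsWithin 0 (Set.Ioi 0)) (nhds 0) := by
  have h : ContinuousAt (fun ε => fano ε L) 0 := by
    have h1 : ContinuousAt (fun ε : ℝ => Real.logb 2 (1 - ε)) 0 := by
      refine ContinuousAt.div_const ?_ _
      exact (continuousAt_const.sub continuousAt_id).log (by simp)
    have h2 : ContinuousAt (fun ε : ℝ => ε * Real.logb 2 ε) 0 := by
      have : (fun ε : ℝ => ε * Real.logb 2 ε) = fun ε => ε * Real.log ε / Real.log 2 := by
        funext ε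
        rw [Real.logb, mul_div_assoc]
      rw [this]
      exact (Real.continuous_mul_log.div_const _).continuousAt
    exact (h1.neg.sub h2).add (continuousAt_id.mul continuousAt_const)
  have h0 : fano 0 L = 0 := by simp [fano]
  have := h.tendsto
  rw [h0] at this
  exact this.mono_left nhdsWithin_le_nhds

end Fano

/-! ### Converse bounds for a single code. -/

namespace Code

variable {X Y A B : Type*} [Fintype X] [Fintype B]
  {n NJ N1 N2 NI : ℕ} {PX : X → ℝ} {W : A → B → ℝ}

/-- A function of Node X's actions that Node Y reproduces has an entropy rate bounded by the
communication rate and by the capacity of the channel. -/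
theorem entropy_le_of_action_error [Fintype Y] [Fintype A]
    (c : Code X Y A B n NJ N1 N2 NI)
    (hPX : PX ∈ stdSimplex ℝ X) (hW : ∀ a, W a ∈ stdSimplex ℝ B)
    (hJ : 0 < NJ) (h1 : 0 < N1) (h2 : 0 < N2) [DecidableEq Y] (f : X → Y) {ε : ℝ}
    (hε : 0 < ε) (hε1 : ε < 1)
    (he : ∑ ω, (if c.action ω.2.2.2.2 ω.2.1 ω.2.2.2.1 ≠ (fun i => f (ω.1 i)) then c.law PX W ω
      else 0) ≤ ε) :
    n * entropy (push PX f) ≤ condH (c.law PX W) c.sent (fun ω => ω.2.1) +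
        fano ε (n * Real.logb 2 (Fintype.card Y)) ∧
      n * entropy (push PX f) ≤ n * capacity W + fano ε (n * Real.logb 2 (Fintype.card Y)) := by
  have hp := c.law_mem_stdSimplex hPX hW hJ h1 h2
  rw [← c.condH_map_actions hPX hW hJ h1 h2 f]
  have hfano := condH_le_fano hp (fun ω i => f (ω.1 i))
    (fun ω => c.action ω.2.2.2.2 ω.2.1 ω.2.2.2.1) hε hε1 he
  have hcard : Real.logb 2 (Fintype.card (Fin n → Y)) = n * Real.logb 2 (Fintype.card Y) := by
    simp [Real.logb_pow]
  rw [hcard] at hfano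
  have hS := c.condH_output hPX hW hJ h1 h2
    (fun ω => (ω.1, ω.2.1, ω.2.2.1, ω.2.2.2.1)) (fun _ _ _ _ _ _ => rfl)
    (fun s => c.codeword (c.message s.1 s.2.1 s.2.2.1) s.2.1) (fun _ => rfl)
  constructor
  -- With F = f(X^n), `e1` and `e3` give H(F|J,M₂) ≤ H(I|J,M₂) + H(F|J,M₂,I). The message and J
  -- determine the input, so both output entropies in `e2` equal the noise and cancel: observing B^n
  -- does not change the last term, which Fano then bounds.
  · have e1 := condH_add_condH hp.1 (fun ω i => f (ω.1 i)) c.sent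
      (fun ω => (ω.2.1, ω.2.2.2.1))
    have e2 := condH_add_condH hp.1 (fun ω i => f (ω.1 i)) output
      (fun ω => ((ω.2.1, ω.2.2.2.1), c.sent ω))
    rw [c.condH_output hPX hW hJ h1 h2 (fun ω => ((ω.2.1, ω.2.2.2.1), c.sent ω))
      (fun _ _ _ _ _ _ => rfl) (fun s => c.codeword s.2 s.1.1) (fun _ => rfl),
      c.condH_output hPX hW hJ h1 h2
      (fun ω => (((ω.2.1, ω.2.2.2.1), c.sent ω), fun i => f (ω.1 i)))
      (fun _ _ _ _ _ _ => rfl) (fun s => c.codeword s.1.2 s.1.1.1) (fun _ => rfl)] at e2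
    have e3 := condH_nonneg hp.1 c.sent
      (fun ω => ((ω.2.1, ω.2.2.2.1), fun i => f (ω.1 i)))
    have e4 := condH_le_of_comp hp c.sent (fun ω => (ω.2.1, ω.2.2.2.1)) Prod.fst
    have e5 := condH_le_of_comp hp (fun ω i => f (ω.1 i))
      (fun ω => (((ω.2.1, ω.2.2.2.1), c.sent ω), output ω))
      (fun w => c.action w.2 w.1.1.1 w.1.1.2)
    simp only at e4 e5
    linarith
  -- Here H(B^n|J,M₂,F) is at least the noise by `e2` and `hS`, while H(B^n|J,M₂) ≤ H(B^n) is at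
  -- most the noise plus nC.
  · have e1 := condH_add_condH hp.1 (fun ω i => f (ω.1 i)) output
      (fun ω => (ω.2.1, ω.2.2.2.1))
    have e2 := condH_le_of_comp hp output (fun ω => (ω.1, ω.2.1, ω.2.2.1, ω.2.2.2.1))
      (fun s => ((s.2.1, s.2.2.2), fun i => f (s.1 i)))
    have e3 := condH_le_of_comp hp output (fun ω => (ω.2.1, ω.2.2.2.1)) (fun _ => ())
    have e4 := condH_le_of_comp hp (fun ω i => f (ω.1 i))
      (fun ω => ((ω.2.1, ω.2.2.2.1), output ω)) (fun w => c.action w.2 w.1.1 w.1.2)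
    have e5 := c.condH_output_const_le hPX hW hJ h1 h2
    simp only at e2 e3 e4
    linarith

/-- A reliably decoded message has rate at most the capacity. -/
theorem condH_sent_le [Fintype A] (c : Code X Y A B n NJ N1 N2 NI)
    (hPX : PX ∈ stdSimplex ℝ X) (hW : ∀ a, W a ∈ stdSimplex ℝ B)
    (hJ : 0 < NJ) (h1 : 0 < N1) (h2 : 0 < N2) {ε : ℝ} (hε : 0 < ε) (hε1 : ε < 1)
    (he : c.messageError PX W ≤ ε) :
    condH (c.law PX W) c.sent (fun ω => ω.2.1) ≤ n * capacity W + fano ε (Real.logb 2 NI) := by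
  have hp := c.law_mem_stdSimplex hPX hW hJ h1 h2
  have hfano := condH_le_fano hp c.sent c.estimated hε hε1 (le_of_eq_of_le (by
    unfold messageError; congr! 2) he)
  rw [Fintype.card_fin] at hfano
  have e1 := condH_add_condH hp.1 c.sent output (fun ω => ω.2.1)
  rw [c.condH_output hPX hW hJ h1 h2 (fun ω => (ω.2.1, c.sent ω))
    (fun _ _ _ _ _ _ => rfl) (fun s => c.codeword s.2 s.1) (fun _ => rfl)] at e1
  have e2 := condH_le_of_comp hp output (fun ω => ω.2.1) (fun _ => ())
  have e3 := condH_le_of_comp hp c.sent (fun ω => (ω.2.1, output ω))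
    (fun w => c.estimate w.2 w.1)
  have e4 := c.condH_output_const_le hPX hW hJ h1 h2
  change _ ≤ condH (c.law PX W) c.sent c.estimated at e3
  linarith

theorem messageRate_eq (c : Code X Y A B n NJ N1 N2 NI) (PX : X → ℝ) (W : A → B → ℝ) :
    c.messageRate PX W = condH (c.law PX W) c.sent (fun ω => ω.2.1) / n := by
  rw [messageRate, condEntropy_push]

theorem messageRate_nonneg (c : Code X Y A B n NJ N1 N2 NI) (hPX : PX ∈ stdSimplex ℝ X)
    (hW : ∀ a, W a ∈ stdSimplex ℝ B) (hJ : 0 < NJ) (h1 : 0 < N1) (h2 : 0 < N2) :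
    0 ≤ c.messageRate PX W := by
  rw [messageRate_eq]
  exact div_nonneg (condH_nonneg (c.law_mem_stdSimplex hPX hW hJ h1 h2).1 _ _) (Nat.cast_nonneg n)

theorem entropy_le [Fintype Y] [Fintype A] (c : Code X Y A B n NJ N1 N2 NI) {Q : X × Y → ℝ}
    (hQ : Q ∈ stdSimplex ℝ (X × Y)) (hdet : condEntropy Q = 0) (hW : ∀ a, W a ∈ stdSimplex ℝ B)
    (hn : 0 < n) (hJ : 0 < NJ) (h1 : 0 < N1) (h2 : 0 < N2) {ε : ℝ} (hε : 0 < ε) (hε1 : ε < 1)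
    (he : c.coordError Q W ≤ ε) :
    entropy (push Q Prod.snd) ≤ c.messageRate (push Q Prod.fst) W +
        fano ε (Real.logb 2 (Fintype.card Y)) ∧
      entropy (push Q Prod.snd) ≤ capacity W + fano ε (Real.logb 2 (Fintype.card Y)) := by
  classical
  have hPX := push_mem_stdSimplex hQ Prod.fst
  obtain ⟨f, hf⟩ := exists_eq_push_of_condEntropy_eq_zero hQ hdet
  have hsnd : push Q Prod.snd = push (push Q Prod.fst) f := by
    conv_lhs => rw [hf, push_push]
  have herr := (sum_ite_le_tvDist (c.law_mem_stdSimplex hPX hW hJ h1 h2) c.actions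
    (iid_mem_stdSimplex hQ n) (fun a => (fun i => (a i).2) ≠ fun i => f (a i).1) (fun a ha => by
      rw [ne_eq, funext_iff, not_forall] at ha
      obtain ⟨i, hi⟩ := ha
      refine Finset.prod_eq_zero (Finset.mem_univ i) ?_
      rw [hf, push_apply]
      refine Finset.sum_eq_zero fun x _ => if_neg fun h => hi ?_
      rw [← h])).trans he
  obtain ⟨ha, hb⟩ := c.entropy_le_of_action_error hPX hW hJ h1 h2 f hε hε1 herr
  have hn1 : (1 : ℝ) ≤ n := by exact_mod_cast hn
  have hn0 : (0 : ℝ) < n := by linarith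
  have hF := fano_mul_le hε hε1 (Real.logb 2 (Fintype.card Y)) hn1
  rw [hsnd, messageRate_eq]
  constructor
  · rw [← sub_le_iff_le_add, le_div_iff₀ hn0]
    linarith
  · refine le_of_mul_le_mul_left ?_ hn0
    linarith

/-- A code with accuracy below `1/2` has nonempty sources of randomness. -/
theorem pos_of_coordError_lt [Fintype Y] (c : Code X Y A B n NJ N1 N2 NI) {Q : X × Y → ℝ}
    (hQ : Q ∈ stdSimplex ℝ (X × Y)) (he : c.coordError Q W < 1 / 2) : 0 < NJ ∧ 0 < N1 ∧ 0 < N2 := by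
  by_contra h
  have hE : IsEmpty (Sample X B n NJ N1 N2) := by
    refine ⟨fun ω => h ⟨?_, ?_, ?_⟩⟩
    · exact Fin.pos ω.2.1
    · exact Fin.pos ω.2.2.1
    · exact Fin.pos ω.2.2.2.1
  -- On an empty sample space the induced law is identically zero, at distance exactly 1/2 from any
  -- pmf.
  have h0 : ∀ a, push (c.law (push Q Prod.fst) W) c.actions a = 0 := by
    classical
    intro a
    simp [push_apply]
  have hq := iid_mem_stdSimplex hQ n
  rw [coordError, tvDist] at he
  simp only [h0, zero_sub, abs_neg, abs_of_nonneg (hq.1 _), hq.2] at he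
  linarith

end Code

theorem logb_size_le (n : ℕ) {R : ℝ} (h : 0 < size n R) : Real.logb 2 (size n R) ≤ n * R := by
  rw [Real.logb_le_iff_le_rpow one_lt_two (by exact_mod_cast h)]
  exact Nat.floor_le (by positivity)

/-! ### Channel coding by Feinstein's method. -/

section ChannelCoding

/-- Feinstein's lemma: a maximal code whose codewords are decoded by thresholding the likelihood
ratio. -/
theorem exists_code_of_threshold {A B : Type*} [Fintype A] [Fintype B] {P : A → ℝ}
    {W : A → B → ℝ} (hP : P ∈ stdSimplex ℝ A) (hW : ∀ a, W a ∈ stdSimplex ℝ B) {γ ε : ℝ}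
    (hγ : 0 < γ) (M : ℕ)
    (h : ∑ a, ∑ b, (if W a b ≤ γ * ∑ a', P a' * W a' b then P a * W a b else 0) + M / γ ≤ ε) :
    ∃ (enc : ℕ → A) (dec : B → ℕ), ∀ m < M,
      ∑ b, (if dec b ≠ m then W (enc m) b else 0) ≤ ε := by
  set q : B → ℝ := fun b => ∑ a', P a' * W a' b with hq
  have hq0 : ∀ b, 0 ≤ q b := fun b => Finset.sum_nonneg fun a _ => mul_nonneg (hP.1 a) ((hW a).1 b)
  have hA : Nonempty A := by
    by_contra h
    rw [not_nonempty_iff] at h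
    simpa using hP.2
  -- The greedy construction carries the threshold as an invariant: each decoding region has q-mass
  -- at most 1/γ, so the regions used so far cover at most M/γ.
  suffices H : ∀ k ≤ M, ∃ (enc : ℕ → A) (dec : B → ℕ), ∀ m < k,
      ∑ b, (if dec b ≠ m then W (enc m) b else 0) ≤ ε ∧
        ∀ b, dec b = m → γ * q b < W (enc m) b by
    obtain ⟨enc, dec, hed⟩ := H M le_rfl
    exact ⟨enc, dec, fun m hm => (hed m hm).1⟩
  intro k
  induction k with
  | zero => exact fun _ => ⟨fun _ => hA.some, fun _ => 0, by simp⟩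
  | succ k ih =>
    intro hk
    obtain ⟨enc, dec, hed⟩ := ih (by omega)
    have hcover : ∑ b, (if dec b < k then q b else 0) ≤ M / γ := by
      calc ∑ b, (if dec b < k then q b else 0)
          = ∑ b, ∑ m ∈ Finset.range k, (if dec b = m then q b else 0) := by
            refine Finset.sum_congr rfl fun b _ => ?_
            rw [Finset.sum_ite_eq]
            simp
        _ = ∑ m ∈ Finset.range k, ∑ b, (if dec b = m then q b else 0) := Finset.sum_comm
        _ ≤ ∑ m ∈ Finset.range k, ∑ b, W (enc m) b / γ := by
            refine Finset.sum_le_sum fun m hm => Finset.sum_le_sum fun b _ => ?_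
            split_ifs with hb
            · rw [le_div_iff₀ hγ, mul_comm]
              exact ((hed m (Finset.mem_range.1 hm)).2 b hb).le
            · exact div_nonneg ((hW _).1 b) hγ.le
        _ = k / γ := by
            simp only [← Finset.sum_div, (hW _).2]
            simp [div_eq_mul_inv]
        _ ≤ M / γ := by
            gcongr
            omega
    -- Averaged over P, the probability of landing in a used region or below the threshold is at
    -- most ε, so some input attains this.
    obtain ⟨a, ha⟩ : ∃ a, ∑ b, (if dec b < k ∨ W a b ≤ γ * q b then W a b else 0) ≤ ε := by
      by_contra! hcon
      obtain ⟨a₀, -, ha₀⟩ : ∃ a ∈ Finset.univ, (0 : ℝ) < P a :=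
        Finset.exists_lt_of_sum_lt (by simp [hP.2])
      have h1 : ∑ a, P a * ε < ∑ a, P a * ∑ b, (if dec b < k ∨ W a b ≤ γ * q b then W a b else 0) :=
        Finset.sum_lt_sum (fun a _ => mul_le_mul_of_nonneg_left (hcon a).le (hP.1 a))
          ⟨a₀, Finset.mem_univ _, mul_lt_mul_of_pos_left (hcon a₀) ha₀⟩
      rw [← Finset.sum_mul, hP.2, one_mul] at h1
      have h2 : ∑ a, P a * ∑ b, (if dec b < k ∨ W a b ≤ γ * q b then W a b else 0) ≤
          ∑ a, ∑ b, (if W a b ≤ γ * q b then P a * W a b else 0) +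
            ∑ a, ∑ b, (if dec b < k then P a * W a b else 0) := by
        rw [← Finset.sum_add_distrib]
        refine Finset.sum_le_sum fun a _ => ?_
        rw [← Finset.sum_add_distrib, Finset.mul_sum]
        refine Finset.sum_le_sum fun b _ => ?_
        have h0 := mul_nonneg (hP.1 a) ((hW a).1 b)
        by_cases h3 : dec b < k <;> by_cases h4 : W a b ≤ γ * q b <;> simp [h3, h4, h0]
      have h3 : ∑ a, ∑ b, (if dec b < k then P a * W a b else 0) =
          ∑ b, (if dec b < k then q b else 0) := by
        rw [Finset.sum_comm]
        refine Finset.sum_congr rfl fun b _ => ?_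
        split_ifs <;> simp [hq]
      linarith
    -- Outputs already assigned keep their label, and k claims the remaining ones above its
    -- threshold. The label k + 1 marks outputs still unassigned, since it is not below k + 1.
    refine ⟨Function.update enc k a,
      fun b => if dec b < k then dec b else if γ * q b < W a b then k else k + 1, fun m hm => ?_⟩
    rcases (Nat.lt_succ_iff.1 hm).lt_or_eq with hmk | rfl
    · have hiff : ∀ b, (if dec b < k then dec b else if γ * q b < W a b then k else k + 1) = m ↔
          dec b = m := by
        intro b
        split_ifs <;> omega
      simp only [ne_eq, hiff, Function.update_of_ne hmk.ne]
      exact hed m hmk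
    · have hiff : ∀ b, (if dec b < m then dec b else if γ * q b < W a b then m else m + 1) = m ↔
          ¬(dec b < m ∨ W a b ≤ γ * q b) := by
        intro b
        rw [not_or, not_le]
        split_ifs with h1 h2
        · exact ⟨fun h => by omega, fun h => absurd h1 h.1⟩
        · exact ⟨fun _ => ⟨h1, h2⟩, fun _ => rfl⟩
        · exact ⟨fun h => by omega, fun h => absurd h.2 h2⟩
      simp only [ne_eq, hiff, not_not, Function.update_self]
      exact ⟨ha, fun b hb => not_le.1 (not_or.1 hb).2⟩

variable {A B : Type*} [Fintype A] [Fintype B]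

theorem size_pos (n : ℕ) {R : ℝ} (hR : 0 ≤ R) : 0 < size n R :=
  Nat.floor_pos.2 (Real.one_le_rpow one_le_two (by positivity))

/-- The joint pmf of input and output words has small probability of a low likelihood ratio. -/
theorem sum_low_likelihood_le {P : A → ℝ} {W : A → B → ℝ} (hP : P ∈ stdSimplex ℝ A)
    (hW : ∀ a, W a ∈ stdSimplex ℝ B) (n : ℕ) (δ : ℝ) :
    ∑ a : Fin n → A, ∑ b : Fin n → B, (if ∏ i, W (a i) (b i) ≤
        (2 : ℝ) ^ (n * (mutualInfo (fun z : A × B => P z.1 * W z.1 z.2) - δ)) *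
          ∑ a' : Fin n → A, iid P n a' * ∏ i, W (a' i) (b i)
      then iid P n a * ∏ i, W (a i) (b i) else 0) ≤
    ∑ z : Fin n → A × B, (if n * δ ≤ |∑ i, Real.logb 2 (W (z i).1 (z i).2 /
        push (fun z : A × B => P z.1 * W z.1 z.2) Prod.snd (z i).2) -
          n * ∑ z : A × B, P z.1 * W z.1 z.2 * Real.logb 2 (W z.1 z.2 /
            push (fun z : A × B => P z.1 * W z.1 z.2) Prod.snd z.2)|
      then iid (fun z : A × B => P z.1 * W z.1 z.2) n z else 0) := by
  classical
  rw [← mutualInfo_eq P hW]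
  set p : A × B → ℝ := fun z => P z.1 * W z.1 z.2 with hp
  have hj : p ∈ stdSimplex ℝ (A × B) := joint_mem_stdSimplex hP hW
  have hout : ∀ b : Fin n → B, ∑ a' : Fin n → A, iid P n a' * ∏ i, W (a' i) (b i) =
      ∏ i, push p Prod.snd (b i) := by
    intro b
    simp only [iid, ← Finset.prod_mul_distrib]
    rw [sum_prod_apply (fun i a => P a * W a (b i))]
    refine Finset.prod_congr rfl fun i _ => ?_
    rw [push_apply, Fintype.sum_prod_type]
    simp [hp]
  rw [← Fintype.sum_prod_type' (f := fun (a : Fin n → A) (b : Fin n → B) =>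
    if ∏ i, W (a i) (b i) ≤ (2 : ℝ) ^ (n * (mutualInfo p - δ)) *
      ∑ a' : Fin n → A, iid P n a' * ∏ i, W (a' i) (b i)
      then iid P n a * ∏ i, W (a i) (b i) else 0),
    ← (Equiv.arrowProdEquivProdArrow (Fin n) (fun _ => A) (fun _ => B)).sum_comp]
  refine Finset.sum_le_sum fun z _ => ?_
  have hz : iid P n (fun i => (z i).1) * ∏ i, W (z i).1 (z i).2 = iid p n z := by
    simp only [iid, ← Finset.prod_mul_distrib, hp]
  simp only [Equiv.arrowProdEquivProdArrow, Equiv.coe_fn_mk, hz, hout]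
  have h0 := iid_nonneg hj.1 n z
  rcases h0.eq_or_lt with h | h
  · simp [← h]
  by_cases h1 : ∏ i, W (z i).1 (z i).2 ≤
      (2 : ℝ) ^ (n * (mutualInfo p - δ)) * ∏ i, push p Prod.snd (z i).2
  · have hpz := fun i => iid_pos hj.1 h i
    have hq := fun i => push_pos hj.1 Prod.snd (hpz i)
    have hw : ∀ i, 0 < W (z i).1 (z i).2 := fun i =>
      pos_of_mul_pos_right (hpz i) (hP.1 _)
    rw [← div_le_iff₀ (Finset.prod_pos fun i _ => hq i), ← Finset.prod_div_distrib,
      ← Real.logb_le_iff_le_rpow one_lt_two (Finset.prod_pos fun i _ => div_pos (hw i) (hq i)),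
      Real.logb_prod _ _ (fun i _ => (div_pos (hw i) (hq i)).ne')] at h1
    rw [if_pos, if_pos]
    · have := neg_abs_le (∑ i, Real.logb 2 (W (z i).1 (z i).2 / push p Prod.snd (z i).2) -
        n * mutualInfo p)
      linarith
    · rw [← div_le_iff₀ (Finset.prod_pos fun i _ => hq i), ← Finset.prod_div_distrib,
        ← Real.logb_le_iff_le_rpow one_lt_two (Finset.prod_pos fun i _ => div_pos (hw i) (hq i)),
        Real.logb_prod _ _ (fun i _ => (div_pos (hw i) (hq i)).ne')]
      exact h1
  · rw [if_neg h1]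
    split_ifs <;> simp [h0]

/-- Channel coding theorem: rates below the mutual information of an input pmf are achieved with
vanishing maximal error probability. -/
theorem eventually_exists_channel_code {P : A → ℝ} {W : A → B → ℝ} (hP : P ∈ stdSimplex ℝ A)
    (hW : ∀ a, W a ∈ stdSimplex ℝ B) {R : ℝ} (hR0 : 0 ≤ R)
    (hR : R < mutualInfo (fun z : A × B => P z.1 * W z.1 z.2)) {ε : ℝ} (hε : 0 < ε) :
    ∀ᶠ n : ℕ in Filter.atTop, ∃ (enc : Fin (size n R) → Fin n → A)
      (dec : (Fin n → B) → Fin (size n R)), ∀ m,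
        ∑ b : Fin n → B, (if dec b ≠ m then ∏ i, W (enc m i) (b i) else 0) ≤ ε := by
  classical
  set I := mutualInfo (fun z : A × B => P z.1 * W z.1 z.2) with hI
  -- Half the gap is given to each error term: the likelihood ratio falls short of its mean by nδ
  -- with vanishing probability, and the threshold 2^(n(I-δ)) makes M/γ at most 2^(-nδ).
  set δ := (I - R) / 2 with hδ
  have hδ0 : 0 < δ := by rw [hδ]; linarith
  have hlim := (tendsto_sum_iid_deviation (joint_mem_stdSimplex hP hW)
    (fun z => Real.logb 2 (W z.1 z.2 / push (fun z : A × B => P z.1 * W z.1 z.2) Prod.snd z.2))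
    hδ0).add (tendsto_pow_atTop_nhds_zero_of_lt_one
      (Real.rpow_nonneg zero_le_two (-δ)) (Real.rpow_lt_one_of_one_lt_of_neg one_lt_two
        (neg_lt_zero.2 hδ0)))
  rw [add_zero] at hlim
  filter_upwards [hlim.eventually_lt_const hε] with n hn
  have hγ : (0 : ℝ) < 2 ^ (n * (I - δ)) := by positivity
  have hM : (size n R : ℝ) / 2 ^ (n * (I - δ)) ≤ ((2 : ℝ) ^ (-δ)) ^ n := by
    have h1 : (size n R : ℝ) ≤ 2 ^ (n * R) := Nat.floor_le (by positivity)
    calc (size n R : ℝ) / 2 ^ (n * (I - δ)) ≤ 2 ^ (n * R) / 2 ^ (n * (I - δ)) := by gcongr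
      _ = ((2 : ℝ) ^ (-δ)) ^ n := by
        rw [← Real.rpow_sub two_pos, ← Real.rpow_mul_natCast zero_le_two]
        congr 1
        rw [hδ]
        ring
  obtain ⟨enc, dec, hed⟩ := exists_code_of_threshold (iid_mem_stdSimplex hP n)
    (W := fun (a : Fin n → A) (b : Fin n → B) => ∏ i, W (a i) (b i))
    (fun a => ⟨fun b => Finset.prod_nonneg fun i _ => (hW _).1 _, Code.sum_output hW a⟩) hγ
    (size n R) ((add_le_add (sum_low_likelihood_le hP hW n δ) hM).trans hn.le)
  -- Labels outside the codebook are sent to message 0, which creates no new errors.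
  refine ⟨fun m => enc m, fun b => if hb : dec b < size n R then ⟨dec b, hb⟩ else
    ⟨0, size_pos n hR0⟩, fun m => le_trans (Finset.sum_le_sum fun b _ => ?_) (hed m m.2)⟩
  have h0 : 0 ≤ ∏ i, W (enc m i) (b i) := Finset.prod_nonneg fun i _ => (hW _).1 _
  by_cases hb : dec b = m
  · simp [hb]
  · rw [if_pos hb]
    split_ifs
    · exact le_rfl
    · exact h0

end ChannelCoding

/-! ### Almost lossless source coding. -/

section SourceCoding

variable {Y : Type*} [Fintype Y]

/-- Source coding theorem: rates above the entropy suffice for almost lossless compression. -/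
theorem eventually_exists_source_code [DecidableEq Y] {p : Y → ℝ} (hp : p ∈ stdSimplex ℝ Y) {R : ℝ}
    (hR0 : 0 ≤ R) (hR : entropy p < R) {ε : ℝ} (hε : 0 < ε) :
    ∀ᶠ n : ℕ in Filter.atTop, ∃ (e : (Fin n → Y) → Fin (size n R))
      (d : Fin (size n R) → Fin n → Y),
        ∑ y : Fin n → Y, (if d (e y) ≠ y then iid p n y else 0) < ε := by
  have hlim := tendsto_sum_iid_deviation hp (fun y => Real.logb 2 (p y)) (sub_pos.2 hR)
  filter_upwards [hlim.eventually_lt_const hε] with n hn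
  have hY : Nonempty Y := by
    by_contra h
    rw [not_nonempty_iff] at h
    simpa using hp.2
  have : NeZero (size n R) := ⟨(size_pos n hR0).ne'⟩
  -- One-sided typicality suffices: total mass 1 limits T to 2^(nR) words, so T can be indexed
  -- injectively, and the law of large numbers makes its complement improbable.
  set T : Finset (Fin n → Y) := {y | (2 : ℝ) ^ (-(n * R)) ≤ iid p n y} with hT
  have hcard : T.card ≤ size n R := by
    refine Nat.le_floor ?_
    have h1 : (T.card : ℝ) * 2 ^ (-(n * R)) ≤ 1 := by
      calc (T.card : ℝ) * 2 ^ (-(n * R)) = ∑ y ∈ T, (2 : ℝ) ^ (-(n * R)) := by simp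
        _ ≤ ∑ y ∈ T, iid p n y := Finset.sum_le_sum fun y hy => (Finset.mem_filter.1 hy).2
        _ ≤ ∑ y, iid p n y := Finset.sum_le_sum_of_subset_of_nonneg (Finset.subset_univ _)
            fun y _ _ => iid_nonneg hp.1 n y
        _ = 1 := (iid_mem_stdSimplex hp n).2
    rwa [Real.rpow_neg zero_le_two, ← div_eq_mul_inv, div_le_one (by positivity)] at h1
  obtain ⟨e, -, he⟩ := T.finite_toSet.exists_injOn_of_encard_le
    (t := (Set.univ : Set (Fin (size n R)))) (by
      rw [Set.encard_coe_eq_coe_finsetCard, Set.encard_univ]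
      simpa using hcard)
  refine ⟨e, Function.invFunOn e T, lt_of_le_of_lt (Finset.sum_le_sum fun y _ => ?_) hn⟩
  have h0 := iid_nonneg hp.1 n y
  rcases h0.eq_or_lt with h | h
  · simp [← h]
  by_cases hy : y ∈ T
  · rw [if_neg (not_not.2 (he.leftInvOn_invFunOn hy))]
    split_ifs <;> simp [h0]
  · rw [hT, Finset.mem_filter, not_and, not_le] at hy
    have h1 := hy (Finset.mem_univ y)
    rw [← Real.logb_lt_iff_lt_rpow one_lt_two h, iid,
      Real.logb_prod _ _ (fun i _ => (iid_pos hp.1 h i).ne')] at h1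
    have h2 : n * (R - entropy p) ≤
        |∑ i, Real.logb 2 (p (y i)) - n * ∑ a, p a * Real.logb 2 (p a)| := by
      have := neg_abs_le (∑ i, Real.logb 2 (p (y i)) - n * ∑ a, p a * Real.logb 2 (p a))
      rw [entropy]
      linarith
    rw [if_pos h2]
    split_ifs <;> simp [h0]

end SourceCoding

/-! ### Separate source and channel coding. -/

section Achievability

variable {X Y A B : Type*} [Fintype X] [Fintype Y] [Fintype A] [Fintype B]

/-- Separate source and channel coding achieves every message rate between the entropy of Node Y's
actions and the capacity. -/
theorem achievableWithMessage {Q : X × Y → ℝ} (hQ : Q ∈ stdSimplex ℝ (X × Y))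
    {W : A → B → ℝ} (hW : ∀ a, W a ∈ stdSimplex ℝ B) (hdet : condEntropy Q = 0)
    {Ro ρ1 ρ2 Rc : ℝ} (hRo : 0 ≤ Ro) (hρ1 : 0 ≤ ρ1) (hρ2 : 0 ≤ ρ2)
    (hRc : entropy (push Q Prod.snd) < Rc) (hcap : Rc < capacity W) :
    AchievableWithMessage Q W Ro ρ1 ρ2 Rc := by
  classical
  intro ε hε
  have hPX := push_mem_stdSimplex hQ Prod.fst
  obtain ⟨f, hf⟩ := exists_eq_push_of_condEntropy_eq_zero hQ hdet
  have hsnd : push Q Prod.snd = push (push Q Prod.fst) f := by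
    conv_lhs => rw [hf, push_push]
  have hQY := push_mem_stdSimplex hQ Prod.snd
  have hRc0 : 0 ≤ Rc := by
    refine le_trans ?_ hRc.le
    rw [entropy, neg_nonneg]
    exact Finset.sum_nonpos fun y _ => mul_nonpos_of_nonneg_of_nonpos (hQY.1 y)
      (Real.logb_nonpos one_lt_two (hQY.1 y)
        ((Finset.single_le_sum (fun y _ => hQY.1 y) (Finset.mem_univ y)).trans_eq hQY.2))
  obtain ⟨P, hP, hPI⟩ : ∃ P ∈ stdSimplex ℝ A,
      Rc < mutualInfo (fun z : A × B => P z.1 * W z.1 z.2) := by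
    rcases (stdSimplex ℝ A).eq_empty_or_nonempty with h | h
    -- Without input letters the supremum is 0 by convention, which contradicts 0 ≤ Rc.
    · rw [capacity, h, Set.image_empty, Real.sSup_empty] at hcap
      linarith
    · obtain ⟨_, ⟨P, hP, rfl⟩, h⟩ := exists_lt_of_lt_csSup (h.image _) hcap
      exact ⟨P, hP, h⟩
  obtain ⟨n, ⟨⟨enc, dec, hch⟩, e, d, hsrc⟩, hn⟩ :=
    (((eventually_exists_channel_code hP hW hRc0 hPI (half_pos (half_pos hε))).and
      (eventually_exists_source_code hQY hRc0 hRc (half_pos hε))).and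
        (Filter.eventually_gt_atTop 0)).exists
  have hJ := size_pos n hRo
  have h1 := size_pos n hρ1
  have h2 := size_pos n hρ2
  let c : Code X Y A B n (size n Ro) (size n ρ1) (size n ρ2) (size n Rc) :=
    { message := fun x _ _ => e fun i => f (x i)
      codeword := fun m _ => enc m
      estimate := fun b _ => dec b
      action := fun b _ _ => d (dec b) }
  have hlaw := c.law_mem_stdSimplex hPX hW hJ h1 h2
  have hmsg : ∑ ω, (if c.estimated ω ≠ c.sent ω then c.law (push Q Prod.fst) W ω else 0) ≤
      ε / 2 / 2 := by
    calc ∑ ω, (if c.estimated ω ≠ c.sent ω then c.law (push Q Prod.fst) W ω else 0)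
        = ∑ ω, c.law (push Q Prod.fst) W ω * (if c.estimated ω ≠ c.sent ω then 1 else 0) := by
          simp
      _ ≤ ∑ ω, c.law (push Q Prod.fst) W ω * (ε / 2 / 2) := by
          rw [c.sum_law_mul, c.sum_law_mul]
          refine Finset.sum_le_sum fun x _ => Finset.sum_le_sum fun j _ =>
            Finset.sum_le_sum fun m₁ _ => Finset.sum_le_sum fun m₂ _ => ?_
          rw [← Finset.sum_mul, Code.sum_output hW, one_mul]
          have := iid_nonneg hPX.1 n x
          refine mul_le_mul_of_nonneg_left (le_of_eq_of_le ?_ (hch (e fun i => f (x i))))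
            (by positivity)
          simp only [mul_ite, mul_one, mul_zero]
          rfl
      _ = ε / 2 / 2 := by rw [← Finset.sum_mul, hlaw.2, one_mul]
  -- The ideal actions live on the same sample space as the actual ones, which provides the coupling
  -- for `tvDist_push_le`.
  have htarget : push (c.law (push Q Prod.fst) W) (fun ω i => (ω.1 i, f (ω.1 i))) = iid Q n := by
    conv_rhs => rw [hf, ← push_iid]
    funext z
    have := c.sum_law_mul_fst (PX := push Q Prod.fst) hW hJ h1 h2
      (fun x => if (fun i => (x i, f (x i))) = z then 1 else 0)
    simpa [push_apply] using this
  have hsource : ∑ ω, (if d (e fun i => f (ω.1 i)) ≠ (fun i => f (ω.1 i)) then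
      c.law (push Q Prod.fst) W ω else 0) < ε / 2 := by
    have hs := c.sum_law_mul_fst (PX := push Q Prod.fst) hW hJ h1 h2
      (fun x => if d (e fun i => f (x i)) ≠ (fun i => f (x i)) then 1 else 0)
    have hy := sum_push_mul (iid (push Q Prod.fst) n) (fun x i => f (x i))
      (fun y => if d (e y) ≠ y then 1 else 0)
    rw [push_iid, ← hsnd, ← hs] at hy
    simp only [mul_ite, mul_one, mul_zero] at hy
    rw [← hy]
    exact hsrc
  refine ⟨n, hn, c, ?_, ?_⟩
  · rw [Code.coordError, ← htarget]
    refine (tvDist_push_le hlaw.1 _ _).trans_lt ?_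
    have hsplit : ∑ ω, (if c.actions ω ≠ (fun i => (ω.1 i, f (ω.1 i))) then
        c.law (push Q Prod.fst) W ω else 0) ≤
        ∑ ω, (if c.estimated ω ≠ c.sent ω then c.law (push Q Prod.fst) W ω else 0) +
          ∑ ω, (if d (e fun i => f (ω.1 i)) ≠ (fun i => f (ω.1 i)) then
            c.law (push Q Prod.fst) W ω else 0) := by
      rw [← Finset.sum_add_distrib]
      refine Finset.sum_le_sum fun ω _ => ?_
      have h0 := hlaw.1 ω
      by_cases h3 : c.estimated ω = c.sent ω
      · by_cases h4 : d (e fun i => f (ω.1 i)) = (fun i => f (ω.1 i))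
        · have h5 : c.actions ω = fun i => (ω.1 i, f (ω.1 i)) := by
            have h6 : d (dec ω.2.2.2.2) = d (e fun i => f (ω.1 i)) := congrArg d h3
            funext i
            exact Prod.ext rfl ((congrFun h6 i).trans (congrFun h4 i))
          simp [h3, h4, h5]
        · simp only [h3, h4, ne_eq, not_true_eq_false, not_false_eq_true, if_true, if_false]
          split_ifs <;> linarith
      · simp only [h3, ne_eq, not_false_eq_true, if_true]
        split_ifs <;> linarith
    linarith
  · refine lt_of_le_of_lt (le_of_eq_of_le ?_ hmsg) (by linarith)
    unfold Code.messageError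
    congr! 2

end Achievability

end StrongCoord

/-! ### The coordination theorem. -/

theorem mainTheorem2 {X Y A B : Type*} [Fintype X] [Fintype Y] [Fintype A] [Fintype B]
    (Q : X × Y → ℝ) (hQ : Q ∈ stdSimplex ℝ (X × Y))
    (W : A → B → ℝ) (hW : ∀ a, W a ∈ stdSimplex ℝ B)
    (hdet : StrongCoord.condEntropy Q = 0) :
    -- achievability, in particular without common or local randomness
    (∀ Ro ρ1 ρ2 : ℝ, 0 ≤ Ro → 0 ≤ ρ1 → 0 ≤ ρ2 →
      (StrongCoord.entropy (StrongCoord.push Q Prod.snd) < StrongCoord.capacity W →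
        StrongCoord.Achievable Q W Ro ρ1 ρ2) ∧
      (∀ Rc : ℝ, StrongCoord.entropy (StrongCoord.push Q Prod.snd) < Rc →
        Rc < StrongCoord.capacity W → StrongCoord.AchievableWithMessage Q W Ro ρ1 ρ2 Rc)) ∧
    -- converse for the codes of a given accuracy
    (∃ δ : ℝ → ℝ, Filter.Tendsto δ (nhdsWithin 0 (Set.Ioi 0)) (nhds 0) ∧
      ∀ ε > 0, ∀ n NJ N1 N2 NI : ℕ, 0 < n → 0 < NJ → 0 < N1 → 0 < N2 →
        ∀ c : StrongCoord.Code X Y A B n NJ N1 N2 NI, c.coordError Q W < ε →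
          StrongCoord.entropy (StrongCoord.push Q Prod.snd) ≤
              c.messageRate (StrongCoord.push Q Prod.fst) W + δ ε ∧
            StrongCoord.entropy (StrongCoord.push Q Prod.snd) ≤
              StrongCoord.capacity W + δ ε) ∧
    -- converse for achievable tuples
    (∀ Ro ρ1 ρ2 : ℝ, StrongCoord.Achievable Q W Ro ρ1 ρ2 →
      StrongCoord.entropy (StrongCoord.push Q Prod.snd) ≤ StrongCoord.capacity W) ∧
    (∀ Ro ρ1 ρ2 Rc : ℝ, StrongCoord.AchievableWithMessage Q W Ro ρ1 ρ2 Rc →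
      StrongCoord.entropy (StrongCoord.push Q Prod.snd) ≤ Rc) ∧
    (∀ Ro ρ1 ρ2 Rc : ℝ, StrongCoord.AchievableWithFullMessage Q W Ro ρ1 ρ2 Rc →
      StrongCoord.entropy (StrongCoord.push Q Prod.snd) ≤ Rc ∧
        Rc ≤ StrongCoord.capacity W) := by
  open StrongCoord in
  have hPX := push_mem_stdSimplex hQ Prod.fst
  -- Accuracy below 1/2 excludes empty randomness alphabets, which can occur because the converse
  -- allows negative rates.
  have hsmall : ∀ᶠ ε : ℝ in nhdsWithin 0 (Set.Ioi 0), 0 < ε ∧ ε < 1 / 2 :=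
    Filter.Eventually.and self_mem_nhdsWithin
      (nhdsWithin_le_nhds (eventually_lt_nhds (by norm_num)))
  have hmessage : ∀ Ro ρ1 ρ2 Rc : ℝ, AchievableWithMessage Q W Ro ρ1 ρ2 Rc →
      entropy (push Q Prod.snd) ≤ Rc := by
    intro Ro ρ1 ρ2 Rc h
    have hlim := (tendsto_fano (Real.logb 2 (Fintype.card Y))).const_add Rc
    rw [add_zero] at hlim
    refine ge_of_tendsto hlim (hsmall.mono fun ε hε => ?_)
    obtain ⟨n, hn, c, hc, -⟩ := h ε hε.1
    obtain ⟨hJ, h1, h2⟩ := c.pos_of_coordError_lt hQ (hc.trans hε.2)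
    have hX := (c.entropy_le hQ hdet hW hn hJ h1 h2 hε.1 (by linarith) hc.le).1
    rw [c.messageRate_eq] at hX
    have hp := c.law_mem_stdSimplex hPX hW hJ h1 h2
    have hcard := condH_le_logb_card hp c.sent (fun ω => ω.2.1)
    rw [Fintype.card_fin] at hcard
    have hne : Nonempty (Sample X B n (size n Ro) (size n ρ1) (size n ρ2)) := by
      by_contra h
      rw [not_nonempty_iff] at h
      simpa using hp.2
    have hlog := logb_size_le n (R := Rc) (Fin.pos (c.sent hne.some))
    have : condH (c.law (push Q Prod.fst) W) c.sent (fun ω => ω.2.1) / n ≤ Rc := by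
      rw [div_le_iff₀ (by exact_mod_cast hn)]
      linarith
    linarith
  refine ⟨fun Ro ρ1 ρ2 hRo hρ1 hρ2 => ⟨fun h ε hε => ?_, fun Rc h1 h2 =>
    achievableWithMessage hQ hW hdet hRo hρ1 hρ2 h1 h2⟩,
    -- For large ε the value H(Y) makes both bounds trivial, as the communication rate and the
    -- capacity are nonnegative; only small ε matters for the limit.
    ⟨fun ε => if ε < 1 / 2 then fano ε (Real.logb 2 (Fintype.card Y)) else
      entropy (push Q Prod.snd), ?_, ?_⟩, fun Ro ρ1 ρ2 h => ?_, hmessage,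
    fun Ro ρ1 ρ2 Rc h => ⟨hmessage Ro ρ1 ρ2 Rc fun ε hε => ?_, ?_⟩⟩
  · obtain ⟨Rc, h1, h2⟩ := exists_between h
    obtain ⟨n, hn, c, hc, -⟩ := achievableWithMessage hQ hW hdet hRo hρ1 hρ2 h1 h2 ε hε
    exact ⟨n, _, hn, c, hc⟩
  · refine (tendsto_fano (Real.logb 2 (Fintype.card Y))).congr' (hsmall.mono fun ε hε => ?_)
    exact (if_pos hε.2).symm
  · intro ε hε n NJ N1 N2 NI hn hJ h1 h2 c hc
    dsimp only
    split_ifs with hε1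
    · exact c.entropy_le hQ hdet hW hn hJ h1 h2 hε (by linarith) hc.le
    · exact ⟨le_add_of_nonneg_left (c.messageRate_nonneg hPX hW hJ h1 h2),
        le_add_of_nonneg_left (capacity_nonneg hW)⟩
  · have hlim := (tendsto_fano (Real.logb 2 (Fintype.card Y))).const_add (capacity W)
    rw [add_zero] at hlim
    refine ge_of_tendsto hlim (hsmall.mono fun ε hε => ?_)
    obtain ⟨n, NI, hn, c, hc⟩ := h ε hε.1
    obtain ⟨hJ, h1, h2⟩ := c.pos_of_coordError_lt hQ (hc.trans hε.2)
    exact (c.entropy_le hQ hdet hW hn hJ h1 h2 hε.1 (by linarith) hc.le).2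
  · obtain ⟨n, hn, c, hc, hm, -⟩ := h ε hε
    exact ⟨n, hn, c, hc, hm⟩
  -- The final bound is Rc ≤ C + `fano ε Rc` + ε. Here Fano is applied to the message, whose
  -- alphabet has at most nRc bits, and the last ε is the slack in the rate.
  · have hlim := ((tendsto_fano Rc).const_add (capacity W)).add
      (Filter.Tendsto.mono_left (Filter.tendsto_id (x := nhds (0 : ℝ)))
        (nhdsWithin_le_nhds (s := Set.Ioi 0)))
    rw [add_zero, add_zero] at hlim
    refine ge_of_tendsto hlim (hsmall.mono fun ε hε => ?_)
    obtain ⟨n, hn, c, hc, hm, hr⟩ := h ε hε.1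
    obtain ⟨hJ, h1, h2⟩ := c.pos_of_coordError_lt hQ (hc.trans hε.2)
    have hp := c.law_mem_stdSimplex hPX hW hJ h1 h2
    have hne : Nonempty (Sample X B n (size n Ro) (size n ρ1) (size n ρ2)) := by
      by_contra h
      rw [not_nonempty_iff] at h
      simpa using hp.2
    have hlog := logb_size_le n (R := Rc) (Fin.pos (c.sent hne.some))
    have hsent := c.condH_sent_le hPX hW hJ h1 h2 hε.1 (by linarith) hm.le
    have hn1 : (1 : ℝ) ≤ n := by exact_mod_cast hn
    have hF := fano_mul_le hε.1 (by linarith) Rc hn1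
    have hF' : fano ε (Real.logb 2 (size n Rc)) ≤ fano ε (n * Rc) := by
      have := mul_le_mul_of_nonneg_left hlog hε.1.le
      simp only [fano]
      linarith
    rw [c.messageRate_eq, lt_div_iff₀ (by linarith)] at hr
    have hfin : (n : ℝ) * (Rc - ε) ≤ n * (capacity W + fano ε Rc) := by linarith
    have := le_of_mul_le_mul_left hfin (by linarith)
    simp only [id]
    linarith
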